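/- Let $G$ be a discrete group and let $\mathcal{B}=\{B_t\}_{t\in G}$ be a Fell bundle over $G$. Let $C^*(\mathcal{B})$ be its full cross-sectional $C^*$-algebra (the enveloping $C^*$-algebra of the convolution $*$-algebra of finitely supported sections, i.e. its completion in the norm $\|\sum_t b_t\|=\sup_\pi\|\sum_t\pi(b_t)\|$, where $\pi$ runs over the $*$-representations of $\mathcal{B}$ on Hilbert spaces), and let $C^*_r(\mathcal{B})$ be its reduced cross-sectional $C^*$-algebra, i.e. the $C^*$-algebra of adjointable operators on the right Hilbert $B_e$-module $\ell^2(\mathcal{B})$ generated by the operators $(\Lambda(b_t)\xi)(s)=b_t\,\xi(t^{-1}s)$, $b_t\in B_t$, $t\in G$. Let $\lambda$ be the left regular representation of $G$ on $\ell^2(G)$, let $C^*_r(G)$ be the $C^*$-algebra generated by $\{\lambda_t\}_{t\in G}$, and let $\otimes_{\min}$ denote the minimal (spatial) tensor product of $C^*$-algebras. For $b_t\in B_t$ write $b_t$ also for its canonical images in $C^*(\mathcal{B})$ and in $C^*_r(\mathcal{B})$. Then there exists an injective $*$-homomorphism $$\Phi : C^*_r(\mathcal{B}) \longrightarrow C^*(\mathcal{B})\otimes_{\min}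 C^*_r(G)$$ such that $\Phi(b_t)=b_t\otimes\lambda_t$ for every $t\in G$ and every $b_t\in B_t$. -/

import Mathlib

open scoped TensorProduct ENNReal

universe u v

noncomputable section

/-! ### Fell bundles over a discrete group -/

/-- A Fell bundle over the discrete group `G`, with Banach space fibres `B t`.
The product of `a : B s` and `b : B t` lies in the fibre over `s * t` and the involution maps `B s`
to the fibre over `s⁻¹`.  To avoid transporting elements along equalities of group elements, the
index `r` of the fibre which contains a product is carried together with a proof of `s * t = r`
(so `r` is not an additional choice), and likewise for the involution. -/
structure FellBundle (G : Type u) [Group G] (B : G → Type v)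
    [∀ t, NormedAddCommGroup (B t)] [∀ t, NormedSpace ℂ (B t)] [∀ t, CompleteSpace (B t)] where
  /-- multiplication `B s × B t → B (s * t)` -/
  fmul : ∀ {r s t : G}, s * t = r → B s → B t → B r
  /-- involution `B s → B s⁻¹` -/
  fstar : ∀ {s t : G}, s⁻¹ = t → B s → B t
  fmul_add : ∀ {r s t : G} (h : s * t = r) (a : B s) (b c : B t),
    fmul h a (b + c) = fmul h a b + fmul h a c
  add_fmul : ∀ {r s t : G} (h : s * t = r) (a b : B s) (c : B t),
    fmul h (a + b) c = fmul h a c + fmul h b c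
  fmul_smul : ∀ {r s t : G} (h : s * t = r) (z : ℂ) (a : B s) (b : B t),
    fmul h a (z • b) = z • fmul h a b
  smul_fmul : ∀ {r s t : G} (h : s * t = r) (z : ℂ) (a : B s) (b : B t),
    fmul h (z • a) b = z • fmul h a b
  fmul_assoc : ∀ {r s t p q w : G} (h₁ : r * s = p) (h₂ : p * t = w) (h₃ : s * t = q)
    (h₄ : r * q = w) (a : B r) (b : B s) (c : B t),
    fmul h₂ (fmul h₁ a b) c = fmul h₄ a (fmul h₃ b c)
  fstar_add : ∀ {s t : G} (h : s⁻¹ = t) (a b : B s), fstar h (a + b) = fstar h a + fstar h b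
  fstar_smul : ∀ {s t : G} (h : s⁻¹ = t) (z : ℂ) (a : B s), fstar h (z • a) = star z • fstar h a
  fstar_fstar : ∀ {s t : G} (h : s⁻¹ = t) (h' : t⁻¹ = s) (a : B s), fstar h' (fstar h a) = a
  fstar_fmul : ∀ {r s t r' s' t' : G} (h : s * t = r) (hr : r⁻¹ = r') (hs : s⁻¹ = s')
    (ht : t⁻¹ = t') (h' : t' * s' = r') (a : B s) (b : B t),
    fstar hr (fmul h a b) = fmul h' (fstar ht b) (fstar hs a)
  norm_fmul_le : ∀ {r s t : G} (h : s * t = r) (a : B s) (b : B t), ‖fmul h a b‖ ≤ ‖a‖ * ‖b‖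
  norm_fstar : ∀ {s t : G} (h : s⁻¹ = t) (a : B s), ‖fstar h a‖ = ‖a‖
  /-- the C⋆-identity `‖b⋆b‖ = ‖b‖²` -/
  norm_fstar_fmul : ∀ {s t : G} (h : s⁻¹ = t) (h' : t * s = 1) (a : B s),
    ‖fmul h' (fstar h a) a‖ = ‖a‖ ^ 2
  /-- `b⋆b` is a positive element of the C⋆-algebra `B 1`, i.e. it is of the form `c⋆c`
  with `c` in `B 1` -/
  fstar_fmul_nonneg : ∀ {s t : G} (h : s⁻¹ = t) (h' : t * s = 1) (a : B s),
    ∃ c : B 1, fmul h' (fstar h a) a = fmul (one_mul 1) (fstar inv_one c) c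

namespace FellBundle

variable {G : Type u} [Group G] {B : G → Type v}
  [∀ t, NormedAddCommGroup (B t)] [∀ t, NormedSpace ℂ (B t)] [∀ t, CompleteSpace (B t)]

/-! ### The unit fibre as a C⋆-algebra -/

/-- The unit fibre of a Fell bundle, regarded as a (possibly non-unital) C⋆-algebra. -/
def UnitFiber (_ : FellBundle G B) : Type v := B 1

variable (𝓑 : FellBundle G B)

instance : NormedAddCommGroup 𝓑.UnitFiber := inferInstanceAs (NormedAddCommGroup (B 1))
instance : NormedSpace ℂ 𝓑.UnitFiber := inferInstanceAs (NormedSpace ℂ (B 1))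
instance : CompleteSpace 𝓑.UnitFiber := inferInstanceAs (CompleteSpace (B 1))

theorem fmul_zero {r s t : G} (h : s * t = r) (a : B s) : 𝓑.fmul h a (0 : B t) = 0 := by
  simpa using 𝓑.fmul_smul h 0 a (0 : B t)

theorem zero_fmul {r s t : G} (h : s * t = r) (b : B t) : 𝓑.fmul h (0 : B s) b = 0 := by
  simpa using 𝓑.smul_fmul h 0 (0 : B s) b

instance : NonUnitalNormedRing 𝓑.UnitFiber where
  __ := (inferInstance : NormedAddCommGroup 𝓑.UnitFiber)
  mul a b := 𝓑.fmul (one_mul 1) a b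
  left_distrib a b c := 𝓑.fmul_add _ a b c
  right_distrib a b c := 𝓑.add_fmul _ a b c
  zero_mul a := 𝓑.zero_fmul _ a
  mul_zero a := 𝓑.fmul_zero _ a
  mul_assoc a b c := 𝓑.fmul_assoc _ _ _ _ a b c
  norm_mul_le a b := 𝓑.norm_fmul_le _ a b

instance : StarRing 𝓑.UnitFiber where
  star a := 𝓑.fstar inv_one a
  star_involutive a := 𝓑.fstar_fstar _ _ a
  star_mul a b := 𝓑.fstar_fmul _ _ _ _ _ a b
  star_add a b := 𝓑.fstar_add _ a b

instance : NonUnitalCStarAlgebra 𝓑.UnitFiber where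
  norm_mul_self_le a := by
    have h := 𝓑.norm_fstar_fmul inv_one (one_mul 1) (a : B 1)
    rw [pow_two] at h
    exact h.ge
  smul_assoc z a b := 𝓑.smul_fmul _ z a b
  smul_comm z a b := (𝓑.fmul_smul _ z a b).symm
  star_smul z a := 𝓑.fstar_smul _ z a

/-- The usual order of the C⋆-algebra `B 1`. -/
instance : PartialOrder 𝓑.UnitFiber := CStarAlgebra.spectralOrder 𝓑.UnitFiber
instance : StarOrderedRing 𝓑.UnitFiber := CStarAlgebra.spectralOrderedRing 𝓑.UnitFiber

theorem unitFiber_mul_def (a b : 𝓑.UnitFiber) : a * b = 𝓑.fmul (one_mul 1) a b := rfl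
theorem unitFiber_star_def (a : 𝓑.UnitFiber) : star a = 𝓑.fstar inv_one a := rfl

/-! ### Each fibre as a right Hilbert module over the unit fibre -/

/-- The `B 1`-valued inner product `⟨a, b⟩ = a⋆b` on a fibre. -/
def fip {t : G} (a b : B t) : 𝓑.UnitFiber := 𝓑.fmul (inv_mul_cancel t) (𝓑.fstar rfl a) b

theorem fip_add_right {t : G} (a b c : B t) : 𝓑.fip a (b + c) = 𝓑.fip a b + 𝓑.fip a c :=
  𝓑.fmul_add _ _ _ _

theorem fip_smul_right {t : G} (z : ℂ) (a b : B t) : 𝓑.fip a (z • b) = z • 𝓑.fip a b :=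
  𝓑.fmul_smul _ _ _ _

theorem star_fip {t : G} (a b : B t) : star (𝓑.fip a b) = 𝓑.fip b a := by
  change 𝓑.fstar inv_one (𝓑.fmul _ (𝓑.fstar rfl a) b) = 𝓑.fmul _ (𝓑.fstar rfl b) a
  rw [𝓑.fstar_fmul (r' := 1) (s' := t) (t' := t⁻¹) _ _ (inv_inv t) rfl (inv_mul_cancel t),
    𝓑.fstar_fstar]

theorem fip_add_left {t : G} (a b c : B t) : 𝓑.fip (a + b) c = 𝓑.fip a c + 𝓑.fip b c := by
  rw [← 𝓑.star_fip, fip_add_right, star_add, star_fip, star_fip]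

theorem fip_smul_left {t : G} (z : ℂ) (a b : B t) : 𝓑.fip (z • a) b = star z • 𝓑.fip a b := by
  rw [← 𝓑.star_fip, fip_smul_right, star_smul, star_fip]

theorem fip_self_nonneg {t : G} (a : B t) : 0 ≤ 𝓑.fip a a := by
  obtain ⟨c, hc⟩ := 𝓑.fstar_fmul_nonneg (rfl : t⁻¹ = t⁻¹) (inv_mul_cancel t) a
  let c' : 𝓑.UnitFiber := c
  have h : 𝓑.fip a a = star c' * c' := hc
  rw [h]
  exact star_mul_self_nonneg _

theorem norm_fip_self {t : G} (a : B t) : ‖𝓑.fip a a‖ = ‖a‖ ^ 2 := 𝓑.norm_fstar_fmul _ _ a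

theorem fip_self_eq_zero {t : G} {a : B t} (h : 𝓑.fip a a = 0) : a = 0 := by
  have := 𝓑.norm_fip_self a
  rw [h, norm_zero] at this
  exact norm_eq_zero.1 (pow_eq_zero_iff two_ne_zero |>.1 this.symm)

theorem fip_sub_right {t : G} (a b c : B t) : 𝓑.fip a (b - c) = 𝓑.fip a b - 𝓑.fip a c :=
  (AddMonoidHom.mk' (𝓑.fip a) (𝓑.fip_add_right a)).map_sub b c

theorem fip_sub_left {t : G} (a b c : B t) : 𝓑.fip (a - b) c = 𝓑.fip a c - 𝓑.fip b c := by
  rw [← 𝓑.star_fip, fip_sub_right, star_sub, star_fip, star_fip]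

/-- The right action of the unit fibre on a fibre. -/
def ract {t : G} (b : B t) (c : 𝓑.UnitFiber) : B t := 𝓑.fmul (mul_one t) b c

/-- The left action of the unit fibre on a fibre. -/
def lact {t : G} (c : 𝓑.UnitFiber) (b : B t) : B t := 𝓑.fmul (one_mul t) c b

theorem fip_ract {t : G} (a b : B t) (c : 𝓑.UnitFiber) :
    𝓑.fip a (𝓑.ract b c) = 𝓑.fip a b * c :=
  (𝓑.fmul_assoc _ _ _ _ _ _ _).symm

theorem ract_fip {t : G} (a b : B t) (c : 𝓑.UnitFiber) :
    𝓑.fip (𝓑.ract a c) b = star c * 𝓑.fip a b := by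
  rw [← star_fip, fip_ract, star_mul, star_fip]

theorem lact_mul {t : G} (c d : 𝓑.UnitFiber) (b : B t) :
    𝓑.lact (c * d) b = 𝓑.lact c (𝓑.lact d b) :=
  𝓑.fmul_assoc _ _ _ _ _ _ _

theorem lact_sub {t : G} (c d : 𝓑.UnitFiber) (b : B t) :
    𝓑.lact (c - d) b = 𝓑.lact c b - 𝓑.lact d b :=
  (AddMonoidHom.mk' (fun c => 𝓑.lact c b) (fun c d => 𝓑.add_fmul _ c d b)).map_sub c d

theorem lact_smul {t : G} (z : ℂ) (c : 𝓑.UnitFiber) (b : B t) :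
    𝓑.lact (z • c) b = z • 𝓑.lact c b :=
  𝓑.smul_fmul _ _ _ _

theorem fip_fmul_left {r s t : G} (h : s * t = r) (h' : s⁻¹ * r = t) (b : B s) (x : B t)
    (y : B r) : 𝓑.fip (𝓑.fmul h b x) y = 𝓑.fip x (𝓑.fmul h' (𝓑.fstar rfl b) y) := by
  change 𝓑.fmul _ (𝓑.fstar rfl (𝓑.fmul h b x)) y = 𝓑.fmul _ (𝓑.fstar rfl x) _
  rw [𝓑.fstar_fmul h rfl rfl rfl (by rw [← h, mul_inv_rev]), 𝓑.fmul_assoc]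

theorem _root_.exists_two_smul_sub_mul_self {A : Type*} [NonUnitalCStarAlgebra A] [PartialOrder A]
    [StarOrderedRing A] (x : A) (hx : 0 ≤ x) (r : ℝ) (hr : 0 ≤ r) (hxr : ‖x‖ ≤ r ^ 2) :
    ∃ y : A, star y = y ∧ (2 * r) • y - y * y = x := by
  have hsa : IsSelfAdjoint x := .of_nonneg hx
  have hf0 : (fun s : ℝ => r - √(r ^ 2 - s)) 0 = 0 := by simp [Real.sqrt_sq hr]
  have hc : Continuous (fun s : ℝ => r - √(r ^ 2 - s)) := by fun_prop
  refine ⟨cfcₙ (fun s : ℝ => r - √(r ^ 2 - s)) x, (cfcₙ_predicate _ x : IsSelfAdjoint _), ?_⟩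
  rw [← cfcₙ_mul _ _ x hc.continuousOn hf0 hc.continuousOn hf0,
    ← cfcₙ_smul (2 * r) _ x hc.continuousOn hf0,
    ← cfcₙ_sub _ _ x (by fun_prop) (by simp [Real.sqrt_sq hr]) (by fun_prop)
      (by simp [Real.sqrt_sq hr])]
  conv_rhs => rw [← cfcₙ_id' ℝ x]
  refine cfcₙ_congr fun s hs => ?_
  have hs' : s ≤ r ^ 2 :=
    (le_abs_self s).trans ((NonUnitalIsometricContinuousFunctionalCalculus.norm_quasispectrum_le x hs).trans hxr)
  have hq := Real.sq_sqrt (sub_nonneg.2 hs')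
  simp only [smul_eq_mul]
  nlinarith

theorem fip_lact {t : G} (c : 𝓑.UnitFiber) (a b : B t) :
    𝓑.fip (𝓑.lact c a) b = 𝓑.fip a (𝓑.lact (star c) b) := by
  refine (𝓑.fip_fmul_left (one_mul t) (by simp) _ a b).trans ?_
  have key : ∀ {s : G} (hs : 1⁻¹ = s) (h : s * t = t),
      𝓑.fmul h (𝓑.fstar hs c) b = 𝓑.lact (star c) b := by
    intro s hs h
    obtain rfl : s = 1 := by rw [← hs, inv_one]
    rfl
  rw [key]

theorem fip_fmul_fmul {r s t : G} (h : s * t = r) (b : B s) (a : B t) :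
    𝓑.fip (𝓑.fmul h b a) (𝓑.fmul h b a) = 𝓑.fip a (𝓑.lact (𝓑.fip b b) a) := by
  rw [𝓑.fip_fmul_left h (by rw [← h]; group)]
  congr 1
  exact (𝓑.fmul_assoc _ _ _ _ _ _ _).symm

/-- The left multiplication operators are bounded: `(ba)⋆(ba) ≤ ‖b‖² a⋆a`. -/
theorem fip_fmul_self_le {r s t : G} (h : s * t = r) (b : B s) (a : B t) :
    𝓑.fip (𝓑.fmul h b a) (𝓑.fmul h b a) ≤ ‖b‖ ^ 2 • 𝓑.fip a a := by
  obtain ⟨y, hy, hyx⟩ := exists_two_smul_sub_mul_self (𝓑.fip b b) (𝓑.fip_self_nonneg b) ‖b‖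
    (norm_nonneg _) (𝓑.norm_fip_self b).le
  have h0 := 𝓑.fip_self_nonneg ((‖b‖ : ℂ) • a - 𝓑.lact y a)
  have h1 : (2 * ‖b‖) • y = (2 * (‖b‖ : ℂ)) • y := by
    rw [← Complex.coe_smul]; push_cast; rfl
  have h2 : ‖b‖ ^ 2 • 𝓑.fip a a = ((‖b‖ : ℂ) ^ 2) • 𝓑.fip a a := by
    rw [← Complex.coe_smul]; push_cast; rfl
  rw [← sub_nonneg, fip_fmul_fmul, ← hyx, h1, h2]
  convert h0 using 1
  simp only [fip_sub_left, fip_sub_right, fip_smul_left, fip_smul_right, fip_lact, hy, lact_sub,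
    lact_smul, lact_mul, Complex.star_def, Complex.conj_ofReal]
  module

/-! ### The right Hilbert `B 1`-module `ℓ²(𝓑)` -/

theorem _root_.summable_of_nonneg_of_le_cstar {A ι : Type*} [NonUnitalCStarAlgebra A]
    [PartialOrder A] [StarOrderedRing A] {f g : ι → A} (hf : ∀ i, 0 ≤ f i) (hfg : ∀ i, f i ≤ g i)
    (hg : Summable g) : Summable f := by
  rw [summable_iff_vanishing_norm] at hg ⊢
  intro ε hε
  obtain ⟨s, hs⟩ := hg ε hε
  refine ⟨s, fun t ht => lt_of_le_of_lt ?_ (hs t ht)⟩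
  exact CStarAlgebra.norm_le_norm_of_nonneg_of_le (Finset.sum_nonneg fun i _ => hf i)
    (Finset.sum_le_sum fun i _ => hfg i)

/-- The square summable sections: those `ξ` for which `∑ t, (ξ t)⋆ (ξ t)` converges
(unconditionally, in norm) in the unit fibre. -/
def l2Submodule : Submodule ℂ (∀ t, B t) where
  carrier := {ξ | Summable fun t => 𝓑.fip (ξ t) (ξ t)}
  zero_mem' := by
    have h (t : G) : 𝓑.fip (0 : B t) 0 = 0 := 𝓑.fmul_zero _ _
    simp [h, summable_zero]
  add_mem' {ξ η} hξ hη := by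
    refine summable_of_nonneg_of_le_cstar (fun t => 𝓑.fip_self_nonneg _) (fun t => ?_)
      ((hξ.add hξ).add (hη.add hη))
    rw [← sub_nonneg]
    convert 𝓑.fip_self_nonneg (ξ t - η t) using 1
    simp only [Pi.add_apply, fip_sub_left, fip_sub_right, fip_add_left, fip_add_right]
    abel
  smul_mem' z ξ hξ := by
    have h : Summable fun t => (z * star z) • 𝓑.fip (ξ t) (ξ t) := hξ.const_smul _
    simpa [fip_smul_left, fip_smul_right, smul_smul] using h

/-- The Hilbert module `ℓ²(𝓑)` of square summable sections of the Fell bundle, with the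
inner product `⟨ξ, η⟩ = ∑ t, (ξ t)⋆ (η t)` and the norm `‖ξ‖ = ‖⟨ξ, ξ⟩‖ ^ (1/2)`. -/
def L2 : Type (max u v) := 𝓑.l2Submodule

namespace L2

variable {𝓑}

instance : AddCommGroup 𝓑.L2 := inferInstanceAs (AddCommGroup 𝓑.l2Submodule)
instance : Module ℂ 𝓑.L2 := inferInstanceAs (Module ℂ 𝓑.l2Submodule)

/-- The section underlying an element of `ℓ²(𝓑)`. -/
def coeFn (ξ : 𝓑.L2) : ∀ t, B t := ξ.1

instance : CoeFun 𝓑.L2 (fun _ => ∀ t, B t) := ⟨coeFn⟩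

/-- A square summable section, as an element of `ℓ²(𝓑)`. -/
def mk (ξ : ∀ t, B t) (h : Summable fun t => 𝓑.fip (ξ t) (ξ t)) : 𝓑.L2 := ⟨ξ, h⟩

@[ext] theorem ext {ξ η : 𝓑.L2} (h : ∀ t, ξ t = η t) : ξ = η := Subtype.ext (funext h)

@[simp] theorem mk_apply (ξ : ∀ t, B t) (h : Summable fun t => 𝓑.fip (ξ t) (ξ t)) (t : G) :
    mk ξ h t = ξ t := rfl
@[simp] theorem zero_apply (t : G) : (0 : 𝓑.L2) t = 0 := rfl
@[simp] theorem add_apply (ξ η : 𝓑.L2) (t : G) : (ξ + η) t = ξ t + η t := rfl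
@[simp] theorem sub_apply (ξ η : 𝓑.L2) (t : G) : (ξ - η) t = ξ t - η t := rfl
@[simp] theorem smul_apply (z : ℂ) (ξ : 𝓑.L2) (t : G) : (z • ξ) t = z • ξ t := rfl

theorem summable_self (ξ : 𝓑.L2) : Summable fun t => 𝓑.fip (ξ t) (ξ t) := ξ.2

theorem summable_fip (ξ η : 𝓑.L2) : Summable fun t => 𝓑.fip (ξ t) (η t) := by
  have h := ((((ξ + η).summable_self.sub (ξ - η).summable_self).const_smul (4⁻¹ : ℂ))).sub
    (((ξ + Complex.I • η).summable_self.sub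
      (ξ - Complex.I • η).summable_self).const_smul (4⁻¹ * Complex.I : ℂ))
  refine h.congr fun t => ?_
  simp only [add_apply, sub_apply, smul_apply, fip_sub_left, fip_sub_right, fip_add_left,
    fip_add_right, fip_smul_left, fip_smul_right, Complex.star_def, Complex.conj_I]
  have hI : Complex.I * Complex.I = -1 := Complex.I_mul_I
  match_scalars <;> ring_nf <;> (simp [Complex.I_sq]; try norm_num)

/-- The inner product `⟨ξ, η⟩ = ∑ t, (ξ t)⋆ (η t)` with values in the unit fibre. -/
def ip (ξ η : 𝓑.L2) : 𝓑.UnitFiber := ∑' t, 𝓑.fip (ξ t) (η t)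

theorem ip_add_right (ξ η ζ : 𝓑.L2) : ip ξ (η + ζ) = ip ξ η + ip ξ ζ := by
  simp only [ip, add_apply, fip_add_right]
  exact (summable_fip ξ η).tsum_add (summable_fip ξ ζ)

theorem ip_smul_right (z : ℂ) (ξ η : 𝓑.L2) : ip ξ (z • η) = z • ip ξ η := by
  simp only [ip, smul_apply, fip_smul_right]
  exact (summable_fip ξ η).tsum_const_smul z

theorem star_ip (ξ η : 𝓑.L2) : star (ip ξ η) = ip η ξ := by
  simp only [ip, tsum_star, star_fip]

theorem ip_add_left (ξ η ζ : 𝓑.L2) : ip (ξ + η) ζ = ip ξ ζ + ip η ζ := by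
  rw [← star_ip, ip_add_right, star_add, star_ip, star_ip]

theorem ip_smul_left (z : ℂ) (ξ η : 𝓑.L2) : ip (z • ξ) η = star z • ip ξ η := by
  rw [← star_ip, ip_smul_right, star_smul, star_ip]

theorem ip_sub_right (ξ η ζ : 𝓑.L2) : ip ξ (η - ζ) = ip ξ η - ip ξ ζ :=
  (AddMonoidHom.mk' (ip ξ) (ip_add_right ξ)).map_sub η ζ

theorem ip_sub_left (ξ η ζ : 𝓑.L2) : ip (ξ - η) ζ = ip ξ ζ - ip η ζ := by
  rw [← star_ip, ip_sub_right, star_sub, star_ip, star_ip]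

theorem ip_self_nonneg (ξ : 𝓑.L2) : 0 ≤ ip ξ ξ := tsum_nonneg fun _ => 𝓑.fip_self_nonneg _

theorem ip_self_eq_zero {ξ : 𝓑.L2} (h : ip ξ ξ = 0) : ξ = 0 := by
  ext t
  refine 𝓑.fip_self_eq_zero (le_antisymm ?_ (𝓑.fip_self_nonneg _))
  rw [← h]
  exact ξ.summable_self.le_tsum t fun _ _ => 𝓑.fip_self_nonneg _

theorem ip_mono {ξ η : 𝓑.L2} (h : ∀ t, 𝓑.fip (ξ t) (ξ t) ≤ 𝓑.fip (η t) (η t)) :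
    ip ξ ξ ≤ ip η η :=
  ξ.summable_self.tsum_le_tsum h η.summable_self

/-- The right action of the unit fibre on `ℓ²(𝓑)`. -/
def ract (ξ : 𝓑.L2) (c : 𝓑.UnitFiber) : 𝓑.L2 :=
  mk (fun t => 𝓑.ract (ξ t) c) (by
    simp only [fip_ract, ract_fip]
    exact (ξ.summable_self.mul_left (star c)).mul_right c)

theorem ip_ract (ξ η : 𝓑.L2) (c : 𝓑.UnitFiber) : ip ξ (ract η c) = ip ξ η * c := by
  simp only [ip, ract, mk_apply, fip_ract]
  exact (summable_fip ξ η).tsum_mul_right c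

theorem ract_ip (ξ η : 𝓑.L2) (c : 𝓑.UnitFiber) : ip (ract ξ c) η = star c * ip ξ η := by
  rw [← star_ip, ip_ract, star_mul, star_ip]

/-- The Cauchy-Schwarz inequality in `ℓ²(𝓑)`. -/
theorem norm_ip_sq_le (ξ η : 𝓑.L2) : ‖ip ξ η‖ ^ 2 ≤ ‖ip ξ ξ‖ * ‖ip η η‖ := by
  rcases eq_or_ne (ip ξ ξ) 0 with h0 | h0
  · obtain rfl := ip_self_eq_zero h0
    have : ip (0 : 𝓑.L2) η = 0 := by simpa using ip_smul_left 0 (0 : 𝓑.L2) η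
    rw [this, norm_zero, zero_pow two_ne_zero]
    positivity
  have hn : 0 < ‖ip ξ ξ‖ := norm_pos_iff.2 h0
  set n := ‖ip ξ ξ‖ with hn_def
  set a := ip ξ η with ha
  have h1 : 0 ≤ ip (ract ξ a - (n : ℂ) • η) (ract ξ a - (n : ℂ) • η) := ip_self_nonneg _
  have h2 : star a * ip ξ ξ * a ≤ n • (star a * a) :=
    CStarAlgebra.star_left_conjugate_le_norm_smul (.of_nonneg (ip_self_nonneg ξ))
  have h3 : ip (ract ξ a - (n : ℂ) • η) (ract ξ a - (n : ℂ) • η) =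
      star a * ip ξ ξ * a - n • (star a * a) - n • (star a * a) + n • n • ip η η := by
    have hs : ip η ξ = star a := by rw [ha, star_ip]
    rw [ip_sub_left, ip_sub_right, ip_sub_right, ip_ract, ip_ract, ract_ip, ip_smul_left,
      ip_smul_left, ip_smul_right, ip_smul_right, ract_ip, hs, ← ha]
    simp only [Complex.star_def, Complex.conj_ofReal, Complex.coe_smul, smul_mul_assoc]
    abel
  rw [h3] at h1
  have h4 : n • (star a * a) ≤ n • n • ip η η := by
    have h5 := add_nonneg h1 (sub_nonneg.2 h2)
    rw [← sub_nonneg]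
    convert h5 using 1
    abel
  have h6 := CStarAlgebra.norm_le_norm_of_nonneg_of_le
    (smul_nonneg hn.le (star_mul_self_nonneg a)) h4
  rw [norm_smul, norm_smul, norm_smul, Real.norm_of_nonneg hn.le, CStarRing.norm_star_mul_self,
    ← pow_two] at h6
  exact le_of_mul_le_mul_left h6 hn

instance : Norm 𝓑.L2 := ⟨fun ξ => √‖ip ξ ξ‖⟩

theorem norm_def (ξ : 𝓑.L2) : ‖ξ‖ = √‖ip ξ ξ‖ := rfl

theorem norm_sq (ξ : 𝓑.L2) : ‖ξ‖ ^ 2 = ‖ip ξ ξ‖ := Real.sq_sqrt (norm_nonneg _)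

theorem norm_ip_le (ξ η : 𝓑.L2) : ‖ip ξ η‖ ≤ ‖ξ‖ * ‖η‖ := by
  rw [norm_def, norm_def, ← Real.sqrt_mul (norm_nonneg _)]
  exact Real.le_sqrt_of_sq_le (norm_ip_sq_le ξ η)

theorem normedSpaceCore : NormedSpace.Core ℂ 𝓑.L2 where
  norm_nonneg ξ := Real.sqrt_nonneg _
  norm_eq_zero_iff ξ := by
    constructor
    · intro h
      rw [norm_def, Real.sqrt_eq_zero (norm_nonneg _), norm_eq_zero] at h
      exact ip_self_eq_zero h
    · rintro rfl
      have : ip (0 : 𝓑.L2) 0 = 0 := by simpa using ip_smul_left 0 (0 : 𝓑.L2) 0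
      simp [norm_def, this]
  norm_smul z ξ := by
    rw [norm_def, norm_def, ip_smul_left, ip_smul_right, norm_smul, norm_smul, norm_star,
      ← mul_assoc, Real.sqrt_mul (by positivity), Real.sqrt_mul_self (norm_nonneg _)]
  norm_triangle ξ η := by
    have h0 (ζ : 𝓑.L2) : 0 ≤ ‖ζ‖ := Real.sqrt_nonneg _
    refine (sq_le_sq₀ (h0 _) (add_nonneg (h0 _) (h0 _))).1 ?_
    rw [norm_sq, ip_add_left, ip_add_right, ip_add_right, add_sq, norm_sq, norm_sq]
    have h1 := norm_ip_le ξ η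
    have h2 := norm_ip_le η ξ
    have h3 := norm_add_le (ip ξ ξ + ip ξ η) (ip η ξ + ip η η)
    have h4 := norm_add_le (ip ξ ξ) (ip ξ η)
    have h5 := norm_add_le (ip η ξ) (ip η η)
    nlinarith

instance : NormedAddCommGroup 𝓑.L2 := NormedAddCommGroup.ofCore normedSpaceCore
instance : NormedSpace ℂ 𝓑.L2 := NormedSpace.ofCore normedSpaceCore

theorem eq_of_ip_right {ξ η : 𝓑.L2} (h : ∀ ζ, ip ζ ξ = ip ζ η) : ξ = η := by
  rw [← sub_eq_zero]
  exact ip_self_eq_zero (by rw [ip_sub_right, h, sub_self])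

end L2

/-! ### Adjointable operators -/

/-- The adjointable operators among the bounded operators on the Hilbert module `ℓ²(𝓑)`. -/
def adjointableOps : Subalgebra ℂ (𝓑.L2 →L[ℂ] 𝓑.L2) where
  carrier := {T | ∃ S : 𝓑.L2 →L[ℂ] 𝓑.L2, ∀ ξ η, L2.ip (T ξ) η = L2.ip ξ (S η)}
  mul_mem' := by
    rintro T T' ⟨S, hS⟩ ⟨S', hS'⟩
    exact ⟨S' * S, fun ξ η => by
      change L2.ip (T (T' ξ)) η = L2.ip ξ (S' (S η))
      rw [hS, hS']⟩
  add_mem' := by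
    rintro T T' ⟨S, hS⟩ ⟨S', hS'⟩
    exact ⟨S + S', fun ξ η => by
      change L2.ip (T ξ + T' ξ) η = L2.ip ξ (S η + S' η)
      rw [L2.ip_add_left, L2.ip_add_right, hS, hS']⟩
  algebraMap_mem' z := ⟨algebraMap ℂ _ (star z), fun ξ η => by
    rw [ContinuousLinearMap.algebraMap_apply, ContinuousLinearMap.algebraMap_apply,
      L2.ip_smul_left, L2.ip_smul_right]⟩

/-- The algebra of adjointable operators on the Hilbert module `ℓ²(𝓑)`, with the operator norm. -/
def Adjointable : Type (max u v) := 𝓑.adjointableOps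

namespace Adjointable

variable {𝓑}

instance : NormedRing 𝓑.Adjointable := inferInstanceAs (NormedRing 𝓑.adjointableOps)
instance : NormedAlgebra ℂ 𝓑.Adjointable := inferInstanceAs (NormedAlgebra ℂ 𝓑.adjointableOps)

/-- The operator underlying an adjointable operator. -/
def toCLM (T : 𝓑.Adjointable) : 𝓑.L2 →L[ℂ] 𝓑.L2 := T.1

/-- The adjoint `T⋆`, determined by `⟨T ξ, η⟩ = ⟨ξ, T⋆ η⟩`. -/
instance : Star 𝓑.Adjointable := ⟨fun T => ⟨T.2.choose, T.1, fun ξ η => by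
  rw [← L2.star_ip, ← T.2.choose_spec, L2.star_ip]⟩⟩

theorem ip_left (T : 𝓑.Adjointable) (ξ η : 𝓑.L2) :
    L2.ip (T.toCLM ξ) η = L2.ip ξ ((star T).toCLM η) := T.2.choose_spec ξ η

theorem star_eq_of {T S : 𝓑.Adjointable} (h : ∀ ξ η, L2.ip (T.toCLM ξ) η = L2.ip ξ (S.toCLM η)) :
    star T = S := by
  refine Subtype.ext (ContinuousLinearMap.ext fun η => L2.eq_of_ip_right fun ξ => ?_)
  change L2.ip ξ ((star T).toCLM η) = L2.ip ξ (S.toCLM η)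
  rw [← ip_left, h]

instance : StarRing 𝓑.Adjointable where
  star_involutive T := star_eq_of fun ξ η => by rw [← L2.star_ip, ← ip_left, L2.star_ip]
  star_mul T S := star_eq_of fun ξ η => by
    change L2.ip (T.toCLM (S.toCLM ξ)) η = L2.ip ξ ((star S).toCLM ((star T).toCLM η))
    rw [ip_left, ip_left]
  star_add T S := star_eq_of fun ξ η => by
    change L2.ip (T.toCLM ξ + S.toCLM ξ) η = L2.ip ξ ((star T).toCLM η + (star S).toCLM η)
    rw [L2.ip_add_left, L2.ip_add_right, ip_left, ip_left]

instance : StarModule ℂ 𝓑.Adjointable where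
  star_smul z T := star_eq_of fun ξ η => by
    change L2.ip (z • T.toCLM ξ) η = L2.ip ξ (star z • (star T).toCLM η)
    rw [L2.ip_smul_left, L2.ip_smul_right, ip_left]

instance : CStarRing 𝓑.Adjointable where
  norm_mul_self_le T := by
    have h : ‖T‖ ≤ √‖star T * T‖ := by
      refine ContinuousLinearMap.opNorm_le_bound T.toCLM (Real.sqrt_nonneg _) fun ξ => ?_
      change ‖T.toCLM ξ‖ ≤ √‖star T * T‖ * ‖ξ‖
      rw [← Real.sqrt_sq (norm_nonneg (T.toCLM ξ)), ← Real.sqrt_sq (norm_nonneg ξ),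
        ← Real.sqrt_mul (norm_nonneg (star T * T))]
      refine Real.sqrt_le_sqrt ?_
      rw [L2.norm_sq, ip_left]
      calc ‖L2.ip ξ ((star T).toCLM (T.toCLM ξ))‖ ≤ ‖ξ‖ * ‖(star T * T).toCLM ξ‖ := L2.norm_ip_le _ _
        _ ≤ ‖ξ‖ * (‖star T * T‖ * ‖ξ‖) := by
          gcongr
          exact (star T * T).toCLM.le_opNorm ξ
        _ = ‖star T * T‖ * ‖ξ‖ ^ 2 := by ring
    calc ‖T‖ * ‖T‖ ≤ √‖star T * T‖ * √‖star T * T‖ := by gcongr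
      _ = ‖star T * T‖ := Real.mul_self_sqrt (norm_nonneg _)

end Adjointable

/-! ### The reduced cross-sectional C⋆-algebra -/

/-- The operator `Λ_t(b)` as a continuous linear map: `(Λ_t(b) ξ)(s) = b ξ(t⁻¹ s)`. -/
def leftMul {t : G} (b : B t) : 𝓑.L2 →L[ℂ] 𝓑.L2 :=
  have hle (ξ : 𝓑.L2) (s : G) :
      𝓑.fip (𝓑.fmul (mul_inv_cancel_left t s) b (ξ (t⁻¹ * s)))
        (𝓑.fmul (mul_inv_cancel_left t s) b (ξ (t⁻¹ * s))) ≤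
      ‖b‖ ^ 2 • 𝓑.fip (ξ (t⁻¹ * s)) (ξ (t⁻¹ * s)) := 𝓑.fip_fmul_self_le _ b _
  have hsum (ξ : 𝓑.L2) : Summable fun s => ‖b‖ ^ 2 • 𝓑.fip (ξ (t⁻¹ * s)) (ξ (t⁻¹ * s)) :=
    (((Equiv.mulLeft t⁻¹).summable_iff (f := fun s => 𝓑.fip (ξ s) (ξ s))).2
      ξ.summable_self).const_smul (‖b‖ ^ 2)
  LinearMap.mkContinuous
    { toFun := fun ξ => L2.mk (fun s => 𝓑.fmul (mul_inv_cancel_left t s) b (ξ (t⁻¹ * s)))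
        (summable_of_nonneg_of_le_cstar (fun _ => 𝓑.fip_self_nonneg _) (hle ξ) (hsum ξ))
      map_add' := fun ξ η => L2.ext fun s => 𝓑.fmul_add _ _ _ _
      map_smul' := fun z ξ => L2.ext fun s => 𝓑.fmul_smul _ _ _ _ }
    ‖b‖ (fun ξ => by
      have hs := summable_of_nonneg_of_le_cstar (fun _ => 𝓑.fip_self_nonneg _) (hle ξ) (hsum ξ)
      have h1 := hs.tsum_le_tsum (hle ξ) (hsum ξ)
      have h2 : ∑' s, ‖b‖ ^ 2 • 𝓑.fip (ξ (t⁻¹ * s)) (ξ (t⁻¹ * s)) = ‖b‖ ^ 2 • L2.ip ξ ξ := by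
        refine Summable.tsum_const_smul (f := fun s => 𝓑.fip (ξ (t⁻¹ * s)) (ξ (t⁻¹ * s))) _
          (((Equiv.mulLeft t⁻¹).summable_iff (f := fun s => 𝓑.fip (ξ s) (ξ s))).2
            ξ.summable_self) |>.trans ?_
        exact congrArg (‖b‖ ^ 2 • ·)
          ((Equiv.mulLeft t⁻¹).tsum_eq (fun s => 𝓑.fip (ξ s) (ξ s)))
      rw [h2] at h1
      have h3 := CStarAlgebra.norm_le_norm_of_nonneg_of_le
        (tsum_nonneg fun _ => 𝓑.fip_self_nonneg _) h1
      rw [norm_smul, norm_pow, norm_norm] at h3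
      refine (sq_le_sq₀ (norm_nonneg _) (by positivity)).1 ?_
      rw [L2.norm_sq, mul_pow, L2.norm_sq]
      exact h3)

theorem leftMul_apply {t : G} (b : B t) (ξ : 𝓑.L2) (s : G) :
    𝓑.leftMul b ξ s = 𝓑.fmul (mul_inv_cancel_left t s) b (ξ (t⁻¹ * s)) := rfl

theorem ip_leftMul {t : G} (b : B t) (ξ η : 𝓑.L2) :
    L2.ip (𝓑.leftMul b ξ) η = L2.ip ξ (𝓑.leftMul (𝓑.fstar rfl b) η) := by
  rw [L2.ip, L2.ip, ← (Equiv.mulLeft t).tsum_eq]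
  refine tsum_congr fun s => ?_
  simp only [Equiv.coe_mulLeft, leftMul_apply]
  have key : ∀ (q : G) (hq : q = s) (h : t * q = t * s) (u : G) (hu : u = t * s)
      (h' : t⁻¹ * u = s), 𝓑.fip (𝓑.fmul h b (ξ q)) (η (t * s)) =
        𝓑.fip (ξ s) (𝓑.fmul h' (𝓑.fstar rfl b) (η u)) := by
    rintro q rfl h u rfl h'
    exact 𝓑.fip_fmul_left h h' b (ξ q) (η (t * q))
  exact key _ (inv_mul_cancel_left t s) _ _ (by rw [inv_inv]) _

/-- The left regular representation `Λ` of the Fell bundle by adjointable operators on `ℓ²(𝓑)`. -/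
def regularRep {t : G} (b : B t) : 𝓑.Adjointable :=
  ⟨𝓑.leftMul b, 𝓑.leftMul (𝓑.fstar rfl b), 𝓑.ip_leftMul b⟩

/-- The reduced cross-sectional C⋆-algebra `C⋆_r(𝓑)`: the C⋆-algebra of adjointable operators on
`ℓ²(𝓑)` generated by the range of the left regular representation. -/
def reducedAlgebra : NonUnitalStarSubalgebra ℂ 𝓑.Adjointable :=
  (NonUnitalStarAlgebra.adjoin ℂ {T | ∃ (t : G) (b : B t), T = 𝓑.regularRep b}).topologicalClosure

/-- The element `b ∈ B t` as an element of `C⋆_r(𝓑)`. -/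
def toReduced {t : G} (b : B t) : 𝓑.reducedAlgebra :=
  ⟨𝓑.regularRep b, NonUnitalStarSubalgebra.le_topologicalClosure _
    (NonUnitalStarAlgebra.subset_adjoin ℂ _ ⟨t, b, rfl⟩)⟩

/-! ### Representations and the full cross-sectional C⋆-algebra -/

/-- A ⋆-representation of the Fell bundle on a Hilbert space `H`. -/
structure Rep (H : Type*) [NormedAddCommGroup H] [InnerProductSpace ℂ H] [CompleteSpace H] where
  /-- the linear maps `π_t : B t → 𝓑(H)` -/
  toFun : ∀ t, B t →ₗ[ℂ] (H →L[ℂ] H)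
  map_fmul : ∀ {r s t : G} (h : s * t = r) (a : B s) (b : B t),
    toFun r (𝓑.fmul h a b) = toFun s a * toFun t b
  map_fstar : ∀ {s t : G} (h : s⁻¹ = t) (a : B s), toFun t (𝓑.fstar h a) = star (toFun s a)

/-- Representations of a Fell bundle are automatically contractive. -/
theorem Rep.norm_le {𝓑 : FellBundle G B} {H : Type*} [NormedAddCommGroup H]
    [InnerProductSpace ℂ H] [CompleteSpace H] (π : 𝓑.Rep H) {t : G} (b : B t) :
    ‖π.toFun t b‖ ≤ ‖b‖ := by
  let π₁ : 𝓑.UnitFiber →⋆ₙₐ[ℂ] (H →L[ℂ] H) :=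
    { toFun := fun a => π.toFun 1 a
      map_smul' := fun z a => (π.toFun 1).map_smul z a
      map_zero' := (π.toFun 1).map_zero
      map_add' := fun a b => (π.toFun 1).map_add a b
      map_mul' := fun a b => π.map_fmul (one_mul 1) a b
      map_star' := fun a => π.map_fstar inv_one a }
  have h1 : ‖π₁ (𝓑.fip b b)‖ ≤ ‖𝓑.fip b b‖ := NonUnitalStarAlgHom.norm_apply_le π₁ _
  have h2 : π₁ (𝓑.fip b b) = star (π.toFun t b) * π.toFun t b := by
    rw [← π.map_fstar rfl]
    exact π.map_fmul (inv_mul_cancel t) (𝓑.fstar rfl b) b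
  rw [h2, CStarRing.norm_star_mul_self, norm_fip_self, ← pow_two] at h1
  exact (sq_le_sq₀ (norm_nonneg _) (norm_nonneg _)).1 h1

/-- A Hilbert space together with a representation of the Fell bundle on it.  The Hilbert spaces
are taken in the universe of the total space of the bundle: every cyclic representation has a copy
there, so this is no restriction for the norms defined by all representations. -/
structure BundledRep : Type (max u v + 1) where
  /-- the Hilbert space -/
  H : Type (max u v)
  [normedAddCommGroup : NormedAddCommGroup H]
  [innerProductSpace : InnerProductSpace ℂ H]
  [completeSpace : CompleteSpace H]
  /-- the representation -/
  rep : 𝓑.Rep H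

attribute [instance] BundledRep.normedAddCommGroup BundledRep.innerProductSpace
  BundledRep.completeSpace

/-- The Hilbert space of the universal representation: the Hilbert sum of the spaces of all
representations of the Fell bundle. -/
abbrev UniversalSpace : Type (max u v + 1) := lp (fun ρ : 𝓑.BundledRep => ρ.H) 2

/-- The universal representation: the direct sum of all representations of the Fell bundle. -/
def universalRep {t : G} (b : B t) : 𝓑.UniversalSpace →L[ℂ] 𝓑.UniversalSpace :=
  lp.mapCLM 2 (fun ρ : 𝓑.BundledRep => ρ.rep.toFun t b) (norm_nonneg b) fun ρ => ρ.rep.norm_le b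

/-- The full cross-sectional C⋆-algebra `C⋆(𝓑)`, i.e. the enveloping C⋆-algebra of the
convolution algebra of the bundle, realized as the C⋆-algebra generated by the range of the
universal representation.  So the norm of a finite sum `∑ b_t` in `C⋆(𝓑)` is the supremum of
`‖∑ π(b_t)‖` over all representations `π` of the bundle. -/
def fullAlgebra :
    NonUnitalStarSubalgebra ℂ (𝓑.UniversalSpace →L[ℂ] 𝓑.UniversalSpace) :=
  (NonUnitalStarAlgebra.adjoin ℂ
    {T | ∃ (t : G) (b : B t), T = 𝓑.universalRep b}).topologicalClosure

/-- The element `b ∈ B t` as an element of `C⋆(𝓑)`. -/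
def toFull {t : G} (b : B t) : 𝓑.fullAlgebra :=
  ⟨𝓑.universalRep b, NonUnitalStarSubalgebra.le_topologicalClosure _
    (NonUnitalStarAlgebra.subset_adjoin ℂ _ ⟨t, b, rfl⟩)⟩

end FellBundle

/-! ### The reduced group C⋆-algebra -/

/-- The left regular representation of `G` on `ℓ²(G)`: `(λ_t ξ)(s) = ξ(t⁻¹ s)`. -/
def groupRegularRep {G : Type u} [Group G] (t : G) :
    lp (fun _ : G => ℂ) 2 →L[ℂ] lp (fun _ : G => ℂ) 2 :=
  have hmem (ξ : lp (fun _ : G => ℂ) 2) : Memℓp (fun s => ξ (t⁻¹ * s)) 2 := by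
    have h := (memℓp_gen_iff (p := 2) (by norm_num)).1 (lp.memℓp ξ)
    refine (memℓp_gen_iff (p := 2) (by norm_num)).2 ?_
    exact ((Equiv.mulLeft t⁻¹).summable_iff (f := fun s => ‖ξ s‖ ^ (2 : ℝ≥0∞).toReal)).2 h
  LinearMap.mkContinuous
    { toFun := fun ξ => ⟨fun s => ξ (t⁻¹ * s), hmem ξ⟩
      map_add' := fun ξ η => by ext s; rfl
      map_smul' := fun z ξ => by ext s; rfl } 1 (fun ξ => by
      rw [one_mul, lp.norm_eq_tsum_rpow (by norm_num), lp.norm_eq_tsum_rpow (by norm_num),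
        ← (Equiv.mulLeft t⁻¹).tsum_eq (fun s => ‖ξ s‖ ^ (2 : ℝ≥0∞).toReal)]
      rfl)

/-- The reduced group C⋆-algebra `C⋆_r(G)`: the C⋆-algebra generated by the operators `λ_t`. -/
def reducedGroupAlgebra (G : Type u) [Group G] :
    NonUnitalStarSubalgebra ℂ (lp (fun _ : G => ℂ) 2 →L[ℂ] lp (fun _ : G => ℂ) 2) :=
  (NonUnitalStarAlgebra.adjoin ℂ (Set.range (groupRegularRep (G := G)))).topologicalClosure

/-- The operator `λ_t` as an element of `C⋆_r(G)`. -/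
def groupUnitary {G : Type u} [Group G] (t : G) : reducedGroupAlgebra G :=
  ⟨groupRegularRep t, NonUnitalStarSubalgebra.le_topologicalClosure _
    (NonUnitalStarAlgebra.subset_adjoin ℂ _ ⟨t, rfl⟩)⟩

/-! ### The minimal tensor product of C⋆-algebras -/

section MinTensor

variable {H K : Type*} [NormedAddCommGroup H] [InnerProductSpace ℂ H] [CompleteSpace H]
  [NormedAddCommGroup K] [InnerProductSpace ℂ K] [CompleteSpace K]

/-- The Hilbert space tensor product: the completion of the algebraic tensor product with respect
to the inner product `⟨x ⊗ y, x' ⊗ y'⟩ = ⟨x, x'⟩ ⟨y, y'⟩`. -/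
def HilbertTensor (H K : Type*) [NormedAddCommGroup H] [InnerProductSpace ℂ H]
    [NormedAddCommGroup K] [InnerProductSpace ℂ K] : Type _ :=
  UniformSpace.Completion (H ⊗[ℂ] K)

instance : NormedAddCommGroup (HilbertTensor H K) :=
  inferInstanceAs (NormedAddCommGroup (UniformSpace.Completion (H ⊗[ℂ] K)))
instance : InnerProductSpace ℂ (HilbertTensor H K) :=
  inferInstanceAs (InnerProductSpace ℂ (UniformSpace.Completion (H ⊗[ℂ] K)))
instance : CompleteSpace (HilbertTensor H K) :=
  inferInstanceAs (CompleteSpace (UniformSpace.Completion (H ⊗[ℂ] K)))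

/-- The operator `a ⊗ d` on the Hilbert space tensor product, with
`(a ⊗ d)(x ⊗ y) = a x ⊗ d y`. -/
def opTensor (a : H →L[ℂ] H) (d : K →L[ℂ] K) : HilbertTensor H K →L[ℂ] HilbertTensor H K :=
  (TensorProduct.mapL a d).completion

/-- The minimal (spatial) tensor product of the C⋆-algebras `A` and `D`, faithfully represented on
the Hilbert spaces `H` and `K`: the norm closure of the ⋆-algebra of operators on the Hilbert
space tensor product of `H` and `K` generated by the operators `a ⊗ d` with `a ∈ A` and `d ∈ D`. -/
def minTensor (A : NonUnitalStarSubalgebra ℂ (H →L[ℂ] H))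
    (D : NonUnitalStarSubalgebra ℂ (K →L[ℂ] K)) :
    NonUnitalStarSubalgebra ℂ (HilbertTensor H K →L[ℂ] HilbertTensor H K) :=
  (NonUnitalStarAlgebra.adjoin ℂ
    {T | ∃ a ∈ A, ∃ d ∈ D, T = opTensor a d}).topologicalClosure

/-- The elementary tensor `a ⊗ d` in the minimal tensor product. -/
def minTensor.tmul {A : NonUnitalStarSubalgebra ℂ (H →L[ℂ] H)}
    {D : NonUnitalStarSubalgebra ℂ (K →L[ℂ] K)} (a : A) (d : D) : minTensor A D :=
  ⟨opTensor a.1 d.1, NonUnitalStarSubalgebra.le_topologicalClosure _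
    (NonUnitalStarAlgebra.subset_adjoin ℂ _ ⟨a.1, a.2, d.1, d.2, rfl⟩)⟩

end MinTensor

end

/-! The argument is Fell absorption carried out with norms only. Fix a representation `π` of the
bundle on `H` and write `T ↦ T'` for the correspondence generated by `Λ(b) ↦ π(b) ⊗ λ_t`. For `r` in
`G` and `h` in `H` the map `V ξ = ∑ s, π(ξ s) h ⊗ δ_{s r}` from `ℓ²(𝓑)` to `H ⊗ ℓ²(G)` satisfies `‖V
ξ‖² = ⟨h, π(⟨ξ, ξ⟩) h⟩` and `T' V = V T` (`Rep.norm_tensorOrbit_sq`,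
`Rep.pairAlgebra_apply_tensorOrbit`).

If `π` is isometric on the unit fibre, the norm of `T ξ` is recovered from the numbers `‖V T ξ‖ =
‖T' V ξ‖`, so `‖T‖ ≤ ‖T'‖` (`Rep.norm_fst_le_norm_snd`). The universal representation has this
property, since each positive functional on the unit fibre induces a representation on a completion
of `ℓ²(𝓑)` (`norm_univRep_one`).

Conversely, on a finite sum `v` of vectors `V ξ` the powers of `T'⋆T'` grow at most like `‖T‖^(2n)`,
which forces `‖T' v‖ ≤ ‖T‖ ‖v‖`. This extends to the closed span of such vectors. That span contains
the range of every `T'`, so `‖T' T'⋆‖ ≤ ‖T‖ ‖T'⋆‖` and hence `‖T'‖ ≤ ‖T‖`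
(`Rep.norm_snd_le_norm_fst`).

The closure of the ⋆-algebra of pairs `(T, T')` is therefore the graph of an isometric
⋆-homomorphism (`exists_starHom_of_norm_eq`). -/

noncomputable section

/-! ### Positive functionals attaining the norm. -/

open scoped ComplexOrder in
/-- In a unital C⋆-algebra, the norm of a positive element is attained by a positive functional
of norm at most one. -/
theorem exists_functional_apply_eq_norm {U : Type*} [CStarAlgebra U] [PartialOrder U]
    [StarOrderedRing U] [Nontrivial U] (x : U) (hx : 0 ≤ x) :
    ∃ g : U →L[ℂ] ℂ, g x = ‖x‖ ∧ (∀ y, ‖g y‖ ≤ ‖y‖) ∧ ∀ y, 0 ≤ y → 0 ≤ g y := by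
  have h1 : ‖(1 : U) + x‖ = 1 + ‖x‖ := by
    refine le_antisymm ((norm_add_le _ _).trans (by rw [CStarRing.norm_one])) ?_
    have h := CStarAlgebra.norm_mem_spectrum_of_nonneg (a := x) hx
    have h' : ‖x‖ + (1 : ℝ) ∈ spectrum ℝ (algebraMap ℝ U 1 + x) :=
      spectrum.add_mem_add_iff.2 h
    rw [map_one] at h'
    have := spectrum.norm_le_norm_of_mem h'
    rw [add_comm]
    exact (le_abs_self _).trans this
  -- A norming functional at `1 + x` norms both summands: the real parts of `g 1` and `g x` are at
  -- most `1` and `‖x‖` and add up to `1 + ‖x‖`. A contractive functional with `g 1 = 1` is then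
  -- positive.
  obtain ⟨g, hg, hgx⟩ := exists_dual_vector'' ℂ ((1 : U) + x)
  have hg' (y : U) : ‖g y‖ ≤ ‖y‖ := (g.le_opNorm y).trans (by
    simpa using mul_le_mul_of_nonneg_right hg (norm_nonneg y))
  have hre (y : U) : (g y).re ≤ ‖y‖ := (Complex.re_le_norm _).trans (hg' y)
  rw [map_add, h1] at hgx
  have hr := congrArg Complex.re hgx
  have h11 := hg' 1
  have hxx := hg' x
  have h12 := hre 1
  have hx2 := hre x
  rw [CStarRing.norm_one] at h11 h12
  have hr' : (g 1).re + (g x).re = 1 + ‖x‖ := by simpa using hr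
  have e1 : (g 1).re = 1 := by linarith
  have ex : (g x).re = ‖x‖ := by linarith
  have eq_of_re {z : ℂ} {r : ℝ} (hz : ‖z‖ ≤ r) (h : z.re = r) : z = r := by
    have h2 := Complex.sq_norm z
    rw [Complex.normSq_apply, h] at h2
    have h3 : ‖z‖ ^ 2 ≤ r ^ 2 := pow_le_pow_left₀ (norm_nonneg _) hz 2
    have h4 : z.im = 0 :=
      mul_self_eq_zero.1 (le_antisymm (by nlinarith) (mul_self_nonneg _))
    exact Complex.ext (by simp [h]) (by simp [h4])
  have g1 : g 1 = 1 := by simpa using eq_of_re h11 e1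
  refine ⟨g, eq_of_re hxx ex, hg', fun y hy => ?_⟩
  rw [Complex.nonneg_iff]
  constructor
  -- Applying `g` to `‖y‖ · 1 - y` gives `‖y‖ - Re g y ≤ ‖y‖`.
  · have h2 : ‖algebraMap ℝ U ‖y‖ - y‖ ≤ ‖y‖ := by
      refine (CStarAlgebra.norm_le_iff_le_algebraMap _ (norm_nonneg y) ?_).2 ?_
      · rw [sub_nonneg]
        exact IsSelfAdjoint.le_algebraMap_norm_self (.of_nonneg hy)
      · exact sub_le_self _ hy
    have h3 := (hre _).trans h2
    rw [Algebra.algebraMap_eq_smul_one, map_sub, ← Complex.coe_smul, map_smul, g1] at h3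
    simpa using h3
  -- The shift `y + i t` moves the imaginary part of `g y` by `t` but the squared norm grows only by
  -- `t²`, so a nonzero imaginary part is impossible.
  · have key (t : ℝ) : ((g y).im + t) ^ 2 ≤ ‖y‖ ^ 2 + t ^ 2 := by
      have h2 : ‖y + (t * Complex.I : ℂ) • 1‖ ^ 2 ≤ ‖y‖ ^ 2 + t ^ 2 := by
        rw [sq, ← CStarRing.norm_star_mul_self]
        have : star (y + (t * Complex.I : ℂ) • 1) * (y + (t * Complex.I : ℂ) • 1) =
            y * y + ((t : ℂ) ^ 2) • 1 := by
          have hsa : star y = y := (IsSelfAdjoint.of_nonneg hy).star_eq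
          rw [star_add, hsa, star_smul, star_one]
          simp only [add_mul, mul_add, smul_mul_assoc, mul_smul_comm, one_mul, mul_one]
          simp only [star_mul', Complex.star_def, Complex.conj_ofReal, Complex.conj_I]
          match_scalars <;> ring_nf
          simp [Complex.I_sq]
        rw [this]
        refine (norm_add_le _ _).trans ?_
        have h3 := norm_mul_le y y
        rw [norm_smul, CStarRing.norm_one]
        simp only [norm_pow, Complex.norm_real, Real.norm_eq_abs, sq_abs, mul_one]
        nlinarith
      refine le_trans ?_ h2
      have h3 := (Complex.abs_im_le_norm _).trans (hg' (y + (t * Complex.I : ℂ) • 1))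
      rw [map_add, map_smul, g1] at h3
      have h4 : |(g y).im + t| ≤ ‖y + (t * Complex.I : ℂ) • 1‖ := by simpa using h3
      rw [← sq_abs]
      exact pow_le_pow_left₀ (abs_nonneg _) h4 2
    by_contra hne
    have hne' : (g y).im ≠ 0 := fun h => hne h.symm
    -- This `t` makes the cross term `2 t Im (g y)` equal to `‖y‖² + 1`, too large for `key`.
    have := key ((‖y‖ ^ 2 + 1) / (2 * (g y).im))
    have e : 2 * (g y).im * ((‖y‖ ^ 2 + 1) / (2 * (g y).im)) = ‖y‖ ^ 2 + 1 := by
      field_simp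
    nlinarith [sq_nonneg (g y).im]

open scoped ComplexOrder in
/-- The norm of a positive element of a C⋆-algebra is attained by a positive functional of norm
at most one. -/
theorem exists_positiveLinearMap_apply_eq_norm {A : Type*} [NonUnitalCStarAlgebra A]
    [PartialOrder A] [StarOrderedRing A] (x : A) (hx : 0 ≤ x) :
    ∃ φ : A →ₚ[ℂ] ℂ, φ x = ‖x‖ ∧ ∀ y, ‖φ y‖ ≤ ‖y‖ := by
  have hnorm (y : A) : ‖(y : Unitization ℂ A)‖ = ‖y‖ := Unitization.norm_inr (𝕜 := ℂ) y
  -- The unitization supplies a unit and is nontrivial even when `A` is zero; it preserves norm and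
  -- order of `A`.
  obtain ⟨g, hgx, hg, hpos⟩ := exists_functional_apply_eq_norm (x : Unitization ℂ A)
    (Unitization.inr_nonneg_iff.2 hx)
  let ι : A →ₗ[ℂ] Unitization ℂ A :=
    { toFun := fun a => (a : Unitization ℂ A)
      map_add' := fun a b => Unitization.inr_add ℂ a b
      map_smul' := fun z a => Unitization.inr_smul ℂ z a }
  exact ⟨PositiveLinearMap.mk₀ (g.toLinearMap ∘ₗ ι) fun y hy =>
      hpos _ (Unitization.inr_nonneg_iff.2 hy),
    hgx.trans (by rw [hnorm]), fun y => (hg _).trans (hnorm y).le⟩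

/-! ### Growth of powers and operator bounds. -/

/-- If the powers of `T⋆T` grow at `v` at most like the powers of `M`, then `‖T v‖² ≤ M ‖v‖²`. -/
theorem ContinuousLinearMap.norm_apply_sq_le_of_norm_pow_apply_le {E : Type*}
    [NormedAddCommGroup E] [InnerProductSpace ℂ E] [CompleteSpace E] (T : E →L[ℂ] E) (v : E)
    {M C : ℝ} (hM : 0 ≤ M) (h : ∀ n : ℕ, ‖((star T * T) ^ n) v‖ ≤ C * M ^ n) :
    ‖T v‖ ^ 2 ≤ M * ‖v‖ ^ 2 := by
  rcases eq_or_ne v 0 with rfl | hv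
  · simp
  have hv' : 0 < ‖v‖ := norm_pos_iff.2 hv
  set a := star T * T with ha
  have hsa : IsSelfAdjoint a := IsSelfAdjoint.star_mul_self T
  -- Since `a` is self-adjoint, `‖a^n v‖² = ⟨a^(2n) v, v⟩`; then Cauchy-Schwarz.
  have hstep (n : ℕ) : ‖(a ^ n) v‖ ^ 2 ≤ ‖(a ^ (2 * n)) v‖ * ‖v‖ := by
    have h1 : inner ℂ ((a ^ n) v) ((a ^ n) v) = inner ℂ ((a ^ (2 * n)) v) v := by
      have h2 := ContinuousLinearMap.adjoint_inner_right (a ^ n) ((a ^ n) v) v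
      rw [← ContinuousLinearMap.star_eq_adjoint, (hsa.pow n).star_eq] at h2
      rw [h2, two_mul, pow_add]
      rfl
    rw [← inner_self_eq_norm_sq (𝕜 := ℂ), h1]
    exact (RCLike.re_le_norm _).trans (norm_inner_le_norm _ _)
  have hpow (k : ℕ) : ‖a v‖ ^ 2 ^ k * ‖v‖ ≤ ‖(a ^ 2 ^ k) v‖ * ‖v‖ ^ 2 ^ k := by
    induction k with
    | zero => simp
    | succ k ih =>
      have h1 := hstep (2 ^ k)
      rw [← pow_succ'] at h1
      have h2 := pow_le_pow_left₀ (by positivity) ih 2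
      rw [mul_pow, mul_pow, ← pow_mul, ← pow_mul, ← pow_succ] at h2
      refine le_of_mul_le_mul_right ?_ hv'
      calc ‖a v‖ ^ 2 ^ (k + 1) * ‖v‖ * ‖v‖ = ‖a v‖ ^ 2 ^ (k + 1) * ‖v‖ ^ 2 := by ring
        _ ≤ _ := h2
        _ ≤ (‖(a ^ 2 ^ (k + 1)) v‖ * ‖v‖) * ‖v‖ ^ 2 ^ (k + 1) := by gcongr
        _ = _ := by ring
  -- Only the growth rate matters, not `C`: if `‖a v‖ > M ‖v‖`, combining `hpow` with the hypothesis
  -- bounds `‖v‖` by `C (M ‖v‖ / ‖a v‖)^(2^k)`, which tends to zero.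
  have hav : ‖a v‖ ≤ M * ‖v‖ := by
    by_contra! hlt
    have h0 : 0 < ‖a v‖ := lt_of_le_of_lt (by positivity) hlt
    have hρ : M * ‖v‖ / ‖a v‖ < 1 := (div_lt_one h0).2 hlt
    have hlim : Filter.Tendsto (fun k : ℕ => C * (M * ‖v‖ / ‖a v‖) ^ 2 ^ k) Filter.atTop
        (nhds (C * 0)) :=
      ((tendsto_pow_atTop_nhds_zero_of_lt_one (by positivity) hρ).comp
        (tendsto_pow_atTop_atTop_of_one_lt one_lt_two)).const_mul C
    rw [mul_zero] at hlim
    refine absurd (ge_of_tendsto' hlim fun k => ?_) (not_le.2 hv')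
    have h1 := (hpow k).trans (mul_le_mul_of_nonneg_right (h (2 ^ k)) (by positivity))
    rw [div_pow, mul_pow, mul_div_assoc', le_div_iff₀ (by positivity)]
    calc ‖v‖ * ‖a v‖ ^ 2 ^ k = ‖a v‖ ^ 2 ^ k * ‖v‖ := mul_comm _ _
      _ ≤ _ := h1
      _ = _ := by ring
  have h1 : ‖T v‖ ^ 2 ≤ ‖a v‖ * ‖v‖ := by
    have h2 := ContinuousLinearMap.adjoint_inner_left T v (T v)
    rw [← inner_self_eq_norm_sq (𝕜 := ℂ), ← h2]
    exact (RCLike.re_le_norm _).trans (norm_inner_le_norm _ _)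
  nlinarith

/-! ### Extension of a norm preserving relation by closing its graph. -/

/-- A norm preserving ⋆-closed linear and multiplicative relation between generators extends to an
isometric ⋆-homomorphism on the closed ⋆-subalgebra which they generate. -/
theorem exists_starHom_of_norm_eq {A C : Type*} [NormedRing A] [NormedAlgebra ℂ A] [StarRing A]
    [StarModule ℂ A] [CStarRing A] [NormedRing C] [NormedAlgebra ℂ C] [StarRing C]
    [StarModule ℂ C] [CStarRing C] [CompleteSpace C] (s : Set (A × C))
    (hs : ∀ p ∈ NonUnitalStarAlgebra.adjoin ℂ s, ‖p.1‖ = ‖p.2‖) :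
    ∃ Φ : (NonUnitalStarAlgebra.adjoin ℂ (Prod.fst '' s)).topologicalClosure →⋆ₙₐ[ℂ] C,
      (∀ x, ‖Φ x‖ = ‖x‖) ∧
      (∀ x, Φ x ∈ (NonUnitalStarAlgebra.adjoin ℂ (Prod.snd '' s)).topologicalClosure) ∧
      ∀ p ∈ s, ∀ h, Φ ⟨p.1, h⟩ = p.2 := by
  let P := NonUnitalStarAlgebra.adjoin ℂ s
  let Γ := P.topologicalClosure
  -- Equality of norms is a closed condition, so it survives on `Γ`; applied to differences it makes
  -- `Γ` single-valued.
  have hΓ : ∀ p ∈ Γ, ‖p.1‖ = ‖p.2‖ := fun p hp =>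
    closure_minimal (t := {p : A × C | ‖p.1‖ = ‖p.2‖}) hs
      (isClosed_eq (by fun_prop) (by fun_prop)) hp
  let f₁ : A × C →⋆ₙₐ[ℂ] A := NonUnitalStarAlgHom.fst ℂ A C
  let f₂ : A × C →⋆ₙₐ[ℂ] C := NonUnitalStarAlgHom.snd ℂ A C
  have huniq (x : A) (y y' : C) (h : (x, y) ∈ Γ) (h' : (x, y') ∈ Γ) : y = y' := by
    have := hΓ _ (sub_mem h h')
    simp only [Prod.mk_sub_mk, sub_self, norm_zero] at this
    exact sub_eq_zero.1 (norm_eq_zero.1 this.symm)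
  have hex (x : A) (hx : x ∈ (NonUnitalStarAlgebra.adjoin ℂ (Prod.fst '' s)).topologicalClosure) :
      ∃ y, (x, y) ∈ Γ := by
    obtain ⟨u, hu, hux⟩ := mem_closure_iff_seq_limit.1 hx
    have hmap : NonUnitalStarAlgebra.adjoin ℂ (Prod.fst '' s) = P.map f₁ :=
      (NonUnitalStarAlgHom.map_adjoin f₁ s).symm
    have h1 (n : ℕ) : ∃ y, (u n, y) ∈ P := by
      have h2 : u n ∈ P.map f₁ := hmap ▸ hu n
      obtain ⟨q, hq, hqu⟩ := NonUnitalStarSubalgebra.mem_map.1 h2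
      exact ⟨q.2, by rw [← hqu]; exact hq⟩
    choose y hy using h1
    -- Norm equality transports Cauchy sequences to the second coordinate, so completeness is needed
    -- for `C` only.
    have hyc : CauchySeq y := by
      have h3 := hux.cauchySeq
      rw [Metric.cauchySeq_iff] at h3 ⊢
      intro ε hε
      obtain ⟨N, hN⟩ := h3 ε hε
      refine ⟨N, fun m hm n hn => ?_⟩
      have h4 := hs _ (sub_mem (hy m) (hy n))
      rw [dist_eq_norm]
      exact h4.symm.trans_lt (by simpa [dist_eq_norm] using hN m hm n hn)
    obtain ⟨z, hz⟩ := cauchySeq_tendsto_of_complete hyc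
    exact ⟨z, mem_closure_of_tendsto (hux.prodMk_nhds hz) (Filter.Eventually.of_forall hy)⟩
  choose! F hF using hex
  refine ⟨{ toFun := fun x => F x.1
            map_smul' := fun z x => huniq _ _ _ (hF _ (z • x).2) (SMulMemClass.smul_mem z (hF _ x.2))
            map_zero' := huniq _ _ _ (hF _ (zero_mem _)) (zero_mem Γ)
            map_add' := fun x y => huniq _ _ _ (hF _ (x + y).2) (add_mem (hF _ x.2) (hF _ y.2))
            map_mul' := fun x y => huniq _ _ _ (hF _ (x * y).2) (mul_mem (hF _ x.2) (hF _ y.2))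
            map_star' := fun x => huniq _ _ _ (hF _ (star x).2) (star_mem (hF _ x.2)) },
    fun x => (hΓ _ (hF _ x.2)).symm, fun x => ?_, fun p hp h => huniq _ _ _ (hF _ h) ?_⟩
  · have h1 : P ≤ (NonUnitalStarAlgebra.adjoin ℂ (Prod.snd '' s)).comap f₂ :=
      NonUnitalStarAlgebra.adjoin_le fun p hp =>
        NonUnitalStarAlgebra.subset_adjoin ℂ _ (Set.mem_image_of_mem _ hp)
    have h2 : Set.MapsTo Prod.snd (P : Set (A × C))
        (NonUnitalStarAlgebra.adjoin ℂ (Prod.snd '' s) : Set C) := fun p hp => h1 hp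
    have h3 := map_mem_closure continuous_snd (hF _ x.2) h2
    exact h3
  · exact NonUnitalStarSubalgebra.le_topologicalClosure _ (NonUnitalStarAlgebra.subset_adjoin ℂ _ hp)

/-! ### Left multiplication operators on `ℓ²(𝓑)`. -/

namespace FellBundle

variable {G : Type u} [Group G] {B : G → Type v}
  [∀ t, NormedAddCommGroup (B t)] [∀ t, NormedSpace ℂ (B t)] [∀ t, CompleteSpace (B t)]
  {𝓑 : FellBundle G B}

theorem leftMul_add {t : G} (a b : B t) : 𝓑.leftMul (a + b) = 𝓑.leftMul a + 𝓑.leftMul b :=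
  ContinuousLinearMap.ext fun _ => L2.ext fun _ => 𝓑.add_fmul _ _ _ _

theorem leftMul_smul {t : G} (z : ℂ) (b : B t) : 𝓑.leftMul (z • b) = z • 𝓑.leftMul b :=
  ContinuousLinearMap.ext fun _ => L2.ext fun _ => 𝓑.smul_fmul _ _ _ _

theorem leftMul_fmul {r s t : G} (h : s * t = r) (a : B s) (b : B t) :
    𝓑.leftMul (𝓑.fmul h a b) = 𝓑.leftMul a * 𝓑.leftMul b := by
  refine ContinuousLinearMap.ext fun ξ => L2.ext fun w => ?_
  change 𝓑.fmul _ (𝓑.fmul h a b) (ξ (r⁻¹ * w)) = 𝓑.fmul _ a (𝓑.fmul _ b (ξ (t⁻¹ * (s⁻¹ * w))))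
  -- The two indices are equal but not definitionally, so their fibres are different types.
  -- Generalising one index to a variable and substituting avoids a cast; the same device recurs
  -- below.
  have key : ∀ (q : G) (hq : q = t⁻¹ * (s⁻¹ * w)) (h₂ : r * q = w),
      𝓑.fmul h₂ (𝓑.fmul h a b) (ξ q) =
        𝓑.fmul (mul_inv_cancel_left s w) a
          (𝓑.fmul (mul_inv_cancel_left t (s⁻¹ * w)) b (ξ (t⁻¹ * (s⁻¹ * w)))) := by
    rintro q rfl h₂
    exact 𝓑.fmul_assoc _ _ _ _ _ _ _
  exact key _ (by rw [← h, mul_inv_rev, mul_assoc]) _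

theorem leftMul_fstar_congr {s t : G} (h : s⁻¹ = t) (a : B s) :
    𝓑.leftMul (𝓑.fstar h a) = 𝓑.leftMul (𝓑.fstar rfl a) := by
  subst h; rfl

theorem ip_leftMul_fstar {s t : G} (h : s⁻¹ = t) (a : B s) (ξ η : 𝓑.L2) :
    L2.ip (𝓑.leftMul a ξ) η = L2.ip ξ (𝓑.leftMul (𝓑.fstar h a) η) := by
  rw [ip_leftMul, leftMul_fstar_congr h]

/-- The inequality is needed in the order of the unit fibre, not just in norm, because a positive
functional will be applied to it to bound left multiplication for the induced seminorm. -/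
theorem ip_leftMul_self_le {t : G} (b : B t) (ξ : 𝓑.L2) :
    L2.ip (𝓑.leftMul b ξ) (𝓑.leftMul b ξ) ≤ ‖b‖ ^ 2 • L2.ip ξ ξ := by
  have hs : Summable fun s => 𝓑.fip (ξ (t⁻¹ * s)) (ξ (t⁻¹ * s)) :=
    ((Equiv.mulLeft t⁻¹).summable_iff (f := fun s => 𝓑.fip (ξ s) (ξ s))).2 ξ.summable_self
  have h2 : ∑' s, ‖b‖ ^ 2 • 𝓑.fip (ξ (t⁻¹ * s)) (ξ (t⁻¹ * s)) = ‖b‖ ^ 2 • L2.ip ξ ξ :=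
    (hs.tsum_const_smul _).trans (congrArg (‖b‖ ^ 2 • ·)
      ((Equiv.mulLeft t⁻¹).tsum_eq (fun s => 𝓑.fip (ξ s) (ξ s))))
  rw [← h2]
  exact (𝓑.leftMul b ξ).summable_self.tsum_le_tsum (fun s => 𝓑.fip_fmul_self_le _ b _)
    (hs.const_smul _)

/-! ### The representation induced from a positive functional on the unit fibre -/

section GNS

open scoped ComplexOrder InnerProductSpace
open UniformSpace

set_option linter.unusedVariables false in
/-- The space `ℓ²(𝓑)` with the semi-inner product `φ ⟨ξ, η⟩`, where `φ` is a positive functional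
on the unit fibre. -/
@[nolint unusedArguments]
def PreInduced (φ : 𝓑.UnitFiber →ₚ[ℂ] ℂ) : Type (max u v) := 𝓑.L2

variable (φ : 𝓑.UnitFiber →ₚ[ℂ] ℂ)

namespace PreInduced

instance : AddCommGroup (PreInduced φ) := inferInstanceAs (AddCommGroup 𝓑.L2)
instance : Module ℂ (PreInduced φ) := inferInstanceAs (Module ℂ 𝓑.L2)

/-- The identity map from `ℓ²(𝓑)`. -/
def ofL2 : 𝓑.L2 ≃ₗ[ℂ] PreInduced φ := LinearEquiv.refl ℂ _

/-- The semi-inner product `φ ⟨ξ, η⟩`. -/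
abbrev core : PreInnerProductSpace.Core ℂ (PreInduced φ) where
  inner ξ η := φ (L2.ip ((ofL2 φ).symm ξ) ((ofL2 φ).symm η))
  conj_inner_symm ξ η := by
    rw [← Complex.star_def, ← map_star φ, L2.star_ip]
  re_inner_nonneg ξ := (RCLike.nonneg_iff.mp (φ.map_nonneg (L2.ip_self_nonneg _))).1
  add_left ξ η ζ := by rw [map_add, L2.ip_add_left, map_add]
  smul_left ξ η z := by
    rw [map_smul, L2.ip_smul_left, map_smul, smul_eq_mul, Complex.star_def]

instance : SeminormedAddCommGroup (PreInduced φ) :=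
  InnerProductSpace.Core.toSeminormedAddCommGroup (c := core φ)
instance : InnerProductSpace ℂ (PreInduced φ) := InnerProductSpace.ofCore (core φ)

theorem inner_ofL2 (ξ η : 𝓑.L2) : ⟪ofL2 φ ξ, ofL2 φ η⟫_ℂ = φ (L2.ip ξ η) := rfl

theorem norm_sq_ofL2 (ξ : 𝓑.L2) : ‖ofL2 φ ξ‖ ^ 2 = (φ (L2.ip ξ ξ)).re := by
  rw [← inner_self_eq_norm_sq (𝕜 := ℂ), inner_ofL2]
  rfl

/-- The left multiplication operators on `ℓ²(𝓑)` with the semi-inner product given by `φ`. -/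
def leftMul {t : G} (b : B t) : PreInduced φ →L[ℂ] PreInduced φ :=
  ((ofL2 φ).toLinearMap ∘ₗ (𝓑.leftMul b).toLinearMap ∘ₗ (ofL2 φ).symm.toLinearMap).mkContinuous
    ‖b‖ fun ξ => by
      obtain ⟨ξ, rfl⟩ := (ofL2 φ).surjective ξ
      change ‖ofL2 φ (𝓑.leftMul b ξ)‖ ≤ _
      rw [← sq_le_sq₀ (norm_nonneg _) (by positivity), mul_pow, norm_sq_ofL2, norm_sq_ofL2]
      have h := (OrderHomClass.mono φ (ip_leftMul_self_le b ξ))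
      have h' : φ (‖b‖ ^ 2 • L2.ip ξ ξ) = ((‖b‖ ^ 2 : ℝ) : ℂ) * φ (L2.ip ξ ξ) := by
        rw [← Complex.coe_smul, map_smul, smul_eq_mul]
      rw [h'] at h
      simpa [← Complex.ofReal_pow] using (Complex.le_def.1 h).1

theorem leftMul_ofL2 {t : G} (b : B t) (ξ : 𝓑.L2) :
    leftMul φ b (ofL2 φ ξ) = ofL2 φ (𝓑.leftMul b ξ) := rfl

theorem leftMul_add {t : G} (a b : B t) :
    leftMul φ (a + b) = leftMul φ a + leftMul φ b :=
  ContinuousLinearMap.ext fun ξ =>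
    congrArg (fun T : 𝓑.L2 →L[ℂ] 𝓑.L2 => ofL2 φ (T ((ofL2 φ).symm ξ))) (FellBundle.leftMul_add a b)

theorem leftMul_smul {t : G} (z : ℂ) (b : B t) :
    leftMul φ (z • b) = z • leftMul φ b :=
  ContinuousLinearMap.ext fun ξ =>
    congrArg (fun T : 𝓑.L2 →L[ℂ] 𝓑.L2 => ofL2 φ (T ((ofL2 φ).symm ξ))) (FellBundle.leftMul_smul z b)

end PreInduced

/-- The representation of a Fell bundle induced from the representation of the unit fibre given by
a positive functional. -/
def inducedRep : 𝓑.Rep (Completion (PreInduced φ)) where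
  toFun t :=
    { toFun := fun b => (PreInduced.leftMul φ b).completion
      map_add' := fun a b => by
        ext x
        induction x using Completion.induction_on with
        | hp => apply isClosed_eq <;> fun_prop
        | ih ξ =>
          rw [add_apply, ContinuousLinearMap.completion_apply_coe,
            ContinuousLinearMap.completion_apply_coe, ContinuousLinearMap.completion_apply_coe,
            PreInduced.leftMul_add, ← Completion.coe_add]
          rfl
      map_smul' := fun z b => by
        ext x
        induction x using Completion.induction_on with
        | hp =>
          exact isClosed_eq (ContinuousLinearMap.continuous _) (ContinuousLinearMap.continuous _)
        | ih ξ =>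
          change _ = z • (PreInduced.leftMul φ b).completion ξ
          rw [ContinuousLinearMap.completion_apply_coe, ContinuousLinearMap.completion_apply_coe,
            PreInduced.leftMul_smul, ← Completion.coe_smul]
          rfl }
  map_fmul h a b := by
    ext x
    induction x using Completion.induction_on with
    | hp => apply isClosed_eq <;> fun_prop
    | ih ξ =>
      obtain ⟨ξ, rfl⟩ := (PreInduced.ofL2 φ).surjective ξ
      change (PreInduced.leftMul φ _).completion _ =
        (PreInduced.leftMul φ a).completion ((PreInduced.leftMul φ b).completion _)
      simp only [ContinuousLinearMap.completion_apply_coe, PreInduced.leftMul_ofL2, leftMul_fmul]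
      rfl
  map_fstar h a := by
    refine (ContinuousLinearMap.eq_adjoint_iff _ _).mpr fun x y => ?_
    induction x, y using Completion.induction_on₂ with
    | hp => apply isClosed_eq <;> fun_prop
    | ih ξ η =>
      obtain ⟨ξ, rfl⟩ := (PreInduced.ofL2 φ).surjective ξ
      obtain ⟨η, rfl⟩ := (PreInduced.ofL2 φ).surjective η
      change ⟪(PreInduced.leftMul φ _).completion _, _⟫_ℂ =
        ⟪_, (PreInduced.leftMul φ a).completion _⟫_ℂ
      simp only [ContinuousLinearMap.completion_apply_coe, PreInduced.leftMul_ofL2,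
        Completion.inner_coe, PreInduced.inner_ofL2]
      rw [← L2.star_ip, ← ip_leftMul_fstar h, L2.star_ip]

theorem inducedRep_coe {t : G} (b : B t) (ξ : 𝓑.L2) :
    (inducedRep φ).toFun t b ((PreInduced.ofL2 φ ξ : PreInduced φ) : Completion (PreInduced φ)) =
      (PreInduced.ofL2 φ (𝓑.leftMul b ξ) : PreInduced φ) :=
  ContinuousLinearMap.completion_apply_coe _ _

end GNS

/-! ### Sections supported at a point -/

open scoped Classical in
/-- The section with value `b` at `t` and zero elsewhere. -/
def L2.single {t : G} (b : B t) : 𝓑.L2 :=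
  L2.mk (Pi.single t b) (summable_of_ne_finset_zero (s := {t}) fun s hs => by
    rw [Pi.single_eq_of_ne (by simpa using hs)]
    exact 𝓑.fmul_zero _ _)

theorem L2.single_self {t : G} (b : B t) : L2.single (𝓑 := 𝓑) b t = b := by
  classical
  exact Pi.single_eq_same t b

theorem L2.single_of_ne {t : G} (b : B t) {s : G} (h : s ≠ t) :
    L2.single (𝓑 := 𝓑) b s = 0 := by
  classical
  exact Pi.single_eq_of_ne h b

theorem L2.ip_single {t : G} (b : B t) (ξ : 𝓑.L2) :
    L2.ip (L2.single b) ξ = 𝓑.fip b (ξ t) := by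
  rw [L2.ip, tsum_eq_single t, L2.single_self]
  intro s hs
  rw [L2.single_of_ne b hs]
  simpa using 𝓑.fip_smul_left 0 (0 : B s) (ξ s)

theorem leftMul_single {r s t : G} (h : s * t = r) (a : B s) (b : B t) :
    𝓑.leftMul a (L2.single b) = L2.single (𝓑.fmul h a b) := by
  subst h
  refine L2.ext fun w => ?_
  rw [leftMul_apply]
  by_cases hw : w = s * t
  · subst hw
    rw [L2.single_self]
    have key : ∀ (q : G) (hq : q = t) (h : s * q = s * t),
        𝓑.fmul h a (L2.single (𝓑 := 𝓑) b q) = 𝓑.fmul rfl a b := by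
      rintro q rfl h
      rw [L2.single_self]
    exact key _ (inv_mul_cancel_left s t) _
  · rw [L2.single_of_ne _ hw, L2.single_of_ne, fmul_zero]
    rintro rfl
    exact hw (mul_inv_cancel_left s w).symm

/-! ### The universal representation -/

theorem fip_one (x y : 𝓑.UnitFiber) : 𝓑.fip (t := 1) x y = star x * y := by
  have key : ∀ (s : G) (hs : 1⁻¹ = s) (h : s * 1 = 1),
      𝓑.fmul h (𝓑.fstar hs x) y = star x * y := by
    intro s hs h
    obtain rfl : s = 1 := by rw [← hs, inv_one]
    rfl
  exact key _ rfl _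

theorem L2.ip_single_self (x : 𝓑.UnitFiber) :
    L2.ip (L2.single (𝓑 := 𝓑) (t := 1) x) (L2.single (t := 1) x) = star x * x := by
  refine (L2.ip_single _ _).trans ((congrArg _ (L2.single_self _)).trans (fip_one x x))

open scoped ComplexOrder in
-- Tests the operator norm on the section with value `c` at `1`, which left multiplication by `a`
-- sends to the one with value `a * c`.
theorem norm_inducedRep_single_le (φ : 𝓑.UnitFiber →ₚ[ℂ] ℂ) (a c : 𝓑.UnitFiber) :
    (φ (star (a * c) * (a * c))).re ≤
      ‖(inducedRep φ).toFun 1 a‖ ^ 2 * (φ (star c * c)).re := by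
  have h1 := ((inducedRep φ).toFun 1 a).le_opNorm
    ((PreInduced.ofL2 φ (L2.single (t := 1) c) : PreInduced φ) :
      UniformSpace.Completion (PreInduced φ))
  have h2 := pow_le_pow_left₀ (norm_nonneg _) h1 2
  have h3 := inducedRep_coe φ (t := 1) a (L2.single (t := 1) c)
  have h4 : 𝓑.leftMul (t := 1) a (L2.single (t := 1) c) = L2.single (t := 1) (a * c) :=
    leftMul_single (one_mul 1) _ _
  rw [h3, UniformSpace.Completion.norm_coe, mul_pow, UniformSpace.Completion.norm_coe, h4,
    PreInduced.norm_sq_ofL2, PreInduced.norm_sq_ofL2, L2.ip_single_self, L2.ip_single_self] at h2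
  exact h2

open scoped ComplexOrder in
/-- Every element of the unit fibre attains its norm in a representation of the bundle. -/
theorem exists_bundledRep_norm_le (a : 𝓑.UnitFiber) :
    ∃ ρ : 𝓑.BundledRep, ‖a‖ ≤ ‖ρ.rep.toFun 1 a‖ := by
  -- The unit fibre may lack a unit, so the test vector is `c = star a`: this yields `‖a‖⁴ ≤ ‖ρ(a)‖²
  -- φ(a a⋆) ≤ ‖ρ(a)‖² ‖a‖²`.
  obtain ⟨φ, hφ, hφ'⟩ := exists_positiveLinearMap_apply_eq_norm (star (a * star a) * (a * star a))
    (star_mul_self_nonneg _)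
  refine ⟨⟨UniformSpace.Completion (PreInduced φ), inducedRep φ⟩, ?_⟩
  change ‖a‖ ≤ ‖(inducedRep φ).toFun 1 a‖
  have h2 := norm_inducedRep_single_le φ a (star a)
  rw [hφ, CStarRing.norm_star_mul_self, CStarRing.norm_self_mul_star, Complex.ofReal_re] at h2
  have h4 : (φ (star (star a) * star a)).re ≤ ‖a‖ ^ 2 := by
    refine (Complex.re_le_norm _).trans ((hφ' _).trans ?_)
    rw [CStarRing.norm_star_mul_self, norm_star, sq]
  rcases eq_or_ne a 0 with rfl | ha
  · rw [norm_zero]; exact norm_nonneg _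
  have ha' : 0 < ‖a‖ ^ 2 := by have := norm_pos_iff.2 ha; positivity
  refine (sq_le_sq₀ (norm_nonneg _) (norm_nonneg _)).1 (le_of_mul_le_mul_right ?_ ha')
  calc ‖a‖ ^ 2 * ‖a‖ ^ 2 = ‖a‖ * ‖a‖ * (‖a‖ * ‖a‖) := by ring
    _ ≤ _ := h2
    _ ≤ _ := by gcongr

variable (𝓑) in
/-- The universal representation, as a representation of the bundle. -/
def univRep : 𝓑.Rep 𝓑.UniversalSpace where
  toFun t :=
    { toFun := 𝓑.universalRep
      map_add' := fun a b => by
        ext x ρ : 3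
        exact congrArg (fun T => T (x ρ)) ((ρ.rep.toFun t).map_add a b)
      map_smul' := fun z a => by
        ext x ρ : 3
        exact congrArg (fun T => T (x ρ)) ((ρ.rep.toFun t).map_smul z a) }
  map_fmul h a b := by
    ext x ρ : 3
    exact congrArg (fun T => T (x ρ)) (ρ.rep.map_fmul h a b)
  map_fstar h a := by
    refine (ContinuousLinearMap.eq_adjoint_iff _ _).mpr fun x y => ?_
    rw [lp.inner_eq_tsum, lp.inner_eq_tsum]
    refine tsum_congr fun ρ => ?_
    change inner ℂ (ρ.rep.toFun _ (𝓑.fstar h a) (x ρ)) (y ρ) =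
      inner ℂ (x ρ) (ρ.rep.toFun _ a (y ρ))
    rw [ρ.rep.map_fstar, ContinuousLinearMap.star_eq_adjoint,
      ContinuousLinearMap.adjoint_inner_left]

/-- A single summand already attains the norm. This is the only special property of the universal
representation that the norm comparison uses. -/
theorem norm_univRep_one (a : B 1) : ‖𝓑.univRep.toFun 1 a‖ = ‖a‖ := by
  classical
  refine le_antisymm (𝓑.univRep.norm_le a) ?_
  obtain ⟨ρ, hρ⟩ := exists_bundledRep_norm_le (𝓑 := 𝓑) a
  refine le_trans hρ (ContinuousLinearMap.opNorm_le_bound _ (norm_nonneg _) fun x => ?_)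
  have h := (𝓑.univRep.toFun 1 a).le_opNorm (lp.single 2 ρ x)
  rw [lp.norm_single (by norm_num)] at h
  refine le_trans ?_ h
  have h2 := lp.norm_apply_le_norm (by norm_num) (𝓑.univRep.toFun 1 a (lp.single 2 ρ x)) ρ
  refine le_trans (le_of_eq ?_) h2
  change _ = ‖ρ.rep.toFun 1 a (lp.single 2 ρ x ρ)‖
  rw [lp.single_apply_self]

end FellBundle

/-! ### Operators on the Hilbert space tensor product -/

section HilbertTensor

open scoped InnerProductSpace

variable {H K : Type*} [NormedAddCommGroup H] [InnerProductSpace ℂ H]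
  [NormedAddCommGroup K] [InnerProductSpace ℂ K]

/-- Tensoring with a fixed vector on the left, as a map into the Hilbert space tensor product. -/
def HilbertTensor.tmulL (x : H) : K →L[ℂ] HilbertTensor H K :=
  UniformSpace.Completion.toComplL.comp (TensorProduct.mkL ℂ H K x)

/-- Tensoring with a fixed unit vector on the right, as an isometry. -/
def HilbertTensor.tmulRight (y : K) (hy : ‖y‖ = 1) : H →ₗᵢ[ℂ] HilbertTensor H K where
  toFun x := HilbertTensor.tmulL x y
  map_add' x x' := congrArg ((↑) : H ⊗[ℂ] K → UniformSpace.Completion (H ⊗[ℂ] K))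
    (TensorProduct.add_tmul x x' y) |>.trans (UniformSpace.Completion.coe_add _ _)
  map_smul' z x := congrArg ((↑) : H ⊗[ℂ] K → UniformSpace.Completion (H ⊗[ℂ] K))
    (TensorProduct.smul_tmul' z x y).symm |>.trans (UniformSpace.Completion.coe_smul _ _)
  norm_map' x := (UniformSpace.Completion.norm_coe _).trans (by
    change ‖x ⊗ₜ[ℂ] y‖ = ‖x‖
    rw [TensorProduct.norm_tmul, hy, mul_one])

theorem HilbertTensor.inner_tmulL (x x' : H) (y y' : K) :
    ⟪HilbertTensor.tmulL x y, HilbertTensor.tmulL x' y'⟫_ℂ = ⟪x, x'⟫_ℂ * ⟪y, y'⟫_ℂ :=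
  (UniformSpace.Completion.inner_coe _ _).trans (TensorProduct.inner_tmul ..)

theorem HilbertTensor.apply_mem_of_forall_tmulL_mem
    (T : HilbertTensor H K →L[ℂ] HilbertTensor H K) (M : Submodule ℂ (HilbertTensor H K))
    (hM : IsClosed (M : Set (HilbertTensor H K)))
    (h : ∀ x y, T (HilbertTensor.tmulL x y) ∈ M) (v : HilbertTensor H K) : T v ∈ M := by
  induction v using UniformSpace.Completion.induction_on with
  | hp => exact hM.preimage T.continuous
  | ih v =>
    induction v using TensorProduct.induction_on with
    | zero =>
      rw [UniformSpace.Completion.coe_zero]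
      convert M.zero_mem
      exact T.map_zero
    | tmul x y => exact h x y
    | add x y hx hy =>
      rw [UniformSpace.Completion.coe_add]
      convert M.add_mem hx hy
      exact T.map_add _ _

theorem opTensor_tmulL (a : H →L[ℂ] H) (d : K →L[ℂ] K) (x : H) (y : K) :
    opTensor a d (HilbertTensor.tmulL x y) = HilbertTensor.tmulL (a x) (d y) :=
  ContinuousLinearMap.completion_apply_coe _ _

variable [CompleteSpace H] [CompleteSpace K]

theorem star_opTensor (a : H →L[ℂ] H) (d : K →L[ℂ] K) :
    star (opTensor a d) = opTensor (star a) (star d) := by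
  refine ((ContinuousLinearMap.eq_adjoint_iff _ _).mpr fun x y => ?_).symm
  induction x, y using UniformSpace.Completion.induction_on₂ with
  | hp =>
    exact isClosed_eq
      (((opTensor (star a) (star d)).continuous.comp continuous_fst).inner continuous_snd)
      (continuous_fst.inner ((opTensor a d).continuous.comp continuous_snd))
  | ih x y =>
    have h1 (x : H ⊗[ℂ] K) (a : H →L[ℂ] H) (d : K →L[ℂ] K) :
        opTensor a d (x : UniformSpace.Completion (H ⊗[ℂ] K)) =
          (TensorProduct.mapL a d x : UniformSpace.Completion (H ⊗[ℂ] K)) :=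
      ContinuousLinearMap.completion_apply_coe _ _
    have h2 : ⟪TensorProduct.mapL (star a) (star d) x, y⟫_ℂ =
        ⟪x, TensorProduct.mapL a d y⟫_ℂ := by
      induction x using TensorProduct.induction_on with
      | zero => simp
      | add x x' hx hx' => rw [map_add, inner_add_left, inner_add_left, hx, hx']
      | tmul x x' =>
        induction y using TensorProduct.induction_on with
        | zero => simp
        | add y y' hy hy' => rw [map_add, inner_add_right, inner_add_right, hy, hy']
        | tmul y y' =>
          rw [TensorProduct.mapL_tmul, TensorProduct.mapL_tmul, TensorProduct.inner_tmul,
            TensorProduct.inner_tmul, ContinuousLinearMap.star_eq_adjoint,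
            ContinuousLinearMap.star_eq_adjoint, ContinuousLinearMap.adjoint_inner_left,
            ContinuousLinearMap.adjoint_inner_left]
    rw [h1, h1]
    have h3 := UniformSpace.Completion.inner_coe (𝕜 := ℂ) x (TensorProduct.mapL a d y)
    have h4 := UniformSpace.Completion.inner_coe (𝕜 := ℂ) (TensorProduct.mapL (star a) (star d) x) y
    exact h4.trans (h2.trans h3.symm)

end HilbertTensor

/-! ### The regular representation of `G` and the basis of `ℓ²(G)`. -/

section GroupRep

open scoped InnerProductSpace

variable {G : Type u}

open scoped Classical in
/-- The canonical basis vectors of `ℓ²(G)`. -/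
def groupBasis (s : G) : lp (fun _ : G => ℂ) 2 := lp.single 2 s 1

theorem norm_groupBasis (s : G) : ‖groupBasis s‖ = 1 := by
  classical
  rw [groupBasis, lp.norm_single (by norm_num), norm_one]

theorem inner_groupBasis_of_ne {s t : G} (h : s ≠ t) : ⟪groupBasis s, groupBasis t⟫_ℂ = 0 := by
  classical
  rw [groupBasis, lp.inner_single_left, groupBasis, lp.single_apply_ne _ _ _ h, inner_zero_right]

theorem hasSum_groupBasis (y : lp (fun _ : G => ℂ) 2) :
    HasSum (fun s => y s • groupBasis s) y := by
  classical
  refine (lp.hasSum_single (by norm_num) y).congr_fun fun s => ?_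
  rw [groupBasis, ← lp.single_smul, smul_eq_mul, mul_one]

/-- Right translation by `r` is injective, so distinct `s` give orthogonal copies of `H`; together
they embed `ℓ²(G, H)` isometrically. -/
theorem orthogonalFamily_tmul_groupBasis [Group G] (H : Type*) [NormedAddCommGroup H]
    [InnerProductSpace ℂ H] (r : G) :
    OrthogonalFamily ℂ (fun _ : G => H) (fun s : G =>
      HilbertTensor.tmulRight (groupBasis (s * r)) (norm_groupBasis _)) := by
  intro s t hst x y
  change ⟪HilbertTensor.tmulL x _, HilbertTensor.tmulL y _⟫_ℂ = 0
  rw [HilbertTensor.inner_tmulL, inner_groupBasis_of_ne (fun h => hst (mul_right_cancel h)),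
    mul_zero]

variable [Group G]

theorem groupRegularRep_apply (t : G) (y : lp (fun _ : G => ℂ) 2) (s : G) :
    groupRegularRep t y s = y (t⁻¹ * s) := rfl

theorem groupRegularRep_groupBasis (t s : G) :
    groupRegularRep t (groupBasis s) = groupBasis (t * s) := by
  classical
  ext w
  rw [groupRegularRep_apply, groupBasis, groupBasis, lp.single_apply, lp.single_apply,
    Pi.single_apply, Pi.single_apply]
  simp [inv_mul_eq_iff_eq_mul]

theorem star_groupRegularRep (t : G) :
    star (groupRegularRep t) = groupRegularRep t⁻¹ := by
  refine ((ContinuousLinearMap.eq_adjoint_iff _ _).mpr fun x y => ?_).symm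
  rw [lp.inner_eq_tsum, lp.inner_eq_tsum, ← (Equiv.mulLeft t⁻¹).tsum_eq]
  refine tsum_congr fun s => ?_
  simp [groupRegularRep_apply]

end GroupRep

/-! ### Maps from `ℓ²(𝓑)` to `H ⊗ ℓ²(G)` intertwining `Λ` and `π ⊗ λ`. -/

namespace FellBundle

variable {G : Type u} [Group G] {B : G → Type v}
  [∀ t, NormedAddCommGroup (B t)] [∀ t, NormedSpace ℂ (B t)] [∀ t, CompleteSpace (B t)]
  {𝓑 : FellBundle G B}

section RepVectors

open scoped InnerProductSpace

variable {H : Type*} [NormedAddCommGroup H] [InnerProductSpace ℂ H] [CompleteSpace H]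
  (π : 𝓑.Rep H)

/-- The restriction of a representation to the unit fibre. -/
def Rep.unitHom : 𝓑.UnitFiber →⋆ₙₐ[ℂ] (H →L[ℂ] H) where
  toFun a := π.toFun 1 a
  map_smul' z a := (π.toFun 1).map_smul z a
  map_zero' := (π.toFun 1).map_zero
  map_add' a b := (π.toFun 1).map_add a b
  map_mul' a b := π.map_fmul (one_mul 1) a b
  map_star' a := π.map_fstar inv_one a

/-- Because `π(x)⋆ π(y) = π(x⋆ y)` and `x⋆ y` lies in the unit fibre. -/
theorem Rep.inner_apply {t : G} (x y : B t) (h : H) :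
    ⟪π.toFun t x h, π.toFun t y h⟫_ℂ = ⟪h, π.unitHom (𝓑.fip x y) h⟫_ℂ := by
  have h1 : π.unitHom (𝓑.fip x y) = star (π.toFun t x) * π.toFun t y := by
    rw [← π.map_fstar rfl]
    exact π.map_fmul _ _ _
  rw [h1, ContinuousLinearMap.star_eq_adjoint]
  exact (ContinuousLinearMap.adjoint_inner_right _ _ _).symm

/-- Apply the continuous additive map `a ↦ Re ⟨h, π(a) h⟩` to the convergent series for `⟨ξ, ξ⟩`. -/
theorem Rep.hasSum_norm_sq (ξ : 𝓑.L2) (h : H) :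
    HasSum (fun s => ‖π.toFun s (ξ s) h‖ ^ 2) (RCLike.re ⟪h, π.unitHom (L2.ip ξ ξ) h⟫_ℂ) := by
  have hc : Continuous fun a : 𝓑.UnitFiber => RCLike.re ⟪h, π.unitHom a h⟫_ℂ := by
    have h1 : Continuous π.unitHom := AddMonoidHomClass.continuous_of_bound π.unitHom 1 fun a => by
      rw [one_mul]
      exact NonUnitalStarAlgHom.norm_apply_le _ _
    fun_prop
  let F : 𝓑.UnitFiber →+ ℝ :=
    { toFun := fun a => RCLike.re ⟪h, π.unitHom a h⟫_ℂ
      map_zero' := by simp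
      map_add' := fun a b => by
        rw [map_add, add_apply, inner_add_right, map_add] }
  have h2 := (ξ.summable_self.hasSum).map F hc
  refine h2.congr_fun fun s => ?_
  change _ = RCLike.re ⟪h, π.unitHom (𝓑.fip (ξ s) (ξ s)) h⟫_ℂ
  rw [← π.inner_apply, inner_self_eq_norm_sq]

/-- The map `ξ ↦ (π(ξ s) h)_s` from `ℓ²(𝓑)` to `ℓ²(G, H)`. -/
def Rep.orbit (h : H) : 𝓑.L2 →ₗ[ℂ] lp (fun _ : G => H) 2 where
  toFun ξ := ⟨fun s => π.toFun s (ξ s) h, (memℓp_gen_iff (by norm_num)).2 (by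
    simpa using (π.hasSum_norm_sq ξ h).summable)⟩
  map_add' ξ η := by
    ext s
    exact congrArg (fun T => T h) ((π.toFun s).map_add (ξ s) (η s))
  map_smul' z ξ := by
    ext s
    exact congrArg (fun T => T h) ((π.toFun s).map_smul z (ξ s))

theorem Rep.norm_orbit_sq (h : H) (ξ : 𝓑.L2) :
    ‖π.orbit h ξ‖ ^ 2 = RCLike.re ⟪h, π.unitHom (L2.ip ξ ξ) h⟫_ℂ := by
  rw [← (π.hasSum_norm_sq ξ h).tsum_eq, ← inner_self_eq_norm_sq (𝕜 := ℂ), lp.inner_eq_tsum,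
    RCLike.re_tsum _ (lp.summable_inner _ _)]
  exact tsum_congr fun s => inner_self_eq_norm_sq _

/-- The vector `∑ s, π(ξ s) h ⊗ δ_{s r}` of `H ⊗ ℓ²(G)`. -/
def Rep.tensorOrbit (r : G) (h : H) : 𝓑.L2 →ₗ[ℂ] HilbertTensor H (lp (fun _ : G => ℂ) 2) :=
  (orthogonalFamily_tmul_groupBasis H r).linearIsometry.toLinearMap ∘ₗ π.orbit h

theorem Rep.hasSum_tensorOrbit (r : G) (h : H) (ξ : 𝓑.L2) :
    HasSum (fun s => HilbertTensor.tmulL (π.toFun s (ξ s) h) (groupBasis (s * r)))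
      (π.tensorOrbit r h ξ) :=
  (orthogonalFamily_tmul_groupBasis H r).hasSum_linearIsometry (π.orbit h ξ)

theorem Rep.norm_tensorOrbit_sq (r : G) (h : H) (ξ : 𝓑.L2) :
    ‖π.tensorOrbit r h ξ‖ ^ 2 = RCLike.re ⟪h, π.unitHom (L2.ip ξ ξ) h⟫_ℂ := by
  rw [← π.norm_orbit_sq]
  exact congrArg (· ^ 2)
    ((orthogonalFamily_tmul_groupBasis H r).linearIsometry.norm_map (π.orbit h ξ))

theorem Rep.norm_tensorOrbit_le (r : G) (h : H) (ξ : 𝓑.L2) :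
    ‖π.tensorOrbit r h ξ‖ ≤ ‖ξ‖ * ‖h‖ := by
  refine (sq_le_sq₀ (norm_nonneg _) (by positivity)).1 ?_
  rw [π.norm_tensorOrbit_sq, mul_pow, L2.norm_sq]
  have h1 : ‖π.unitHom (L2.ip ξ ξ)‖ ≤ ‖L2.ip ξ ξ‖ := NonUnitalStarAlgHom.norm_apply_le _ _
  calc _ ≤ ‖h‖ * ‖π.unitHom (L2.ip ξ ξ) h‖ :=
        (RCLike.re_le_norm _).trans (norm_inner_le_norm _ _)
    _ ≤ ‖h‖ * (‖L2.ip ξ ξ‖ * ‖h‖) := by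
        gcongr
        exact ContinuousLinearMap.le_of_opNorm_le _ h1 h
    _ = _ := by ring

/-- The intertwining relation. The term at `s` on the left is the term at `t * s` on the right, and
the right translation by `r` commutes with the left translation by `t`. -/
theorem Rep.opTensor_tensorOrbit (r : G) (h : H) {t : G} (b : B t) (ξ : 𝓑.L2) :
    opTensor (π.toFun t b) (groupRegularRep t) (π.tensorOrbit r h ξ) =
      π.tensorOrbit r h (𝓑.leftMul b ξ) := by
  have h1 := (π.hasSum_tensorOrbit r h ξ).mapL (opTensor (π.toFun t b) (groupRegularRep t))
  have h2 := (Equiv.mulLeft t).hasSum_iff.2 (π.hasSum_tensorOrbit r h (𝓑.leftMul b ξ))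
  refine h1.unique (h2.congr_fun fun s => ?_)
  rw [opTensor_tmulL, groupRegularRep_groupBasis]
  simp only [Function.comp_apply, Equiv.coe_mulLeft, leftMul_apply, mul_assoc]
  have key : ∀ (q : G) (hq : q = s) (h' : t * q = t * s),
      π.toFun t b (π.toFun s (ξ s) h) = π.toFun (t * s) (𝓑.fmul h' b (ξ q)) h := by
    rintro q rfl h'
    rw [π.map_fmul]
    rfl
  rw [key _ (inv_mul_cancel_left t s)]

theorem Rep.tensorOrbit_single (r : G) (h : H) {t : G} (b : B t) :
    π.tensorOrbit r h (L2.single b) =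
      HilbertTensor.tmulL (π.toFun t b h) (groupBasis (t * r)) := by
  refine (π.hasSum_tensorOrbit r h (L2.single b)).unique ?_
  have h1 := hasSum_single (f := fun s => HilbertTensor.tmulL
    (π.toFun s (L2.single (𝓑 := 𝓑) b s) h) (groupBasis (s * r))) t fun s hs => by
      rw [L2.single_of_ne b hs, map_zero]
      exact (HilbertTensor.tmulRight (groupBasis (s * r)) (norm_groupBasis _)).map_zero
  rwa [L2.single_self] at h1

/-- The closed subspace of `H ⊗ ℓ²(G)` spanned by the vectors `∑ s, π(ξ s) h ⊗ δ_{s r}`. -/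
def Rep.essentialSubspace : Submodule ℂ (HilbertTensor H (lp (fun _ : G => ℂ) 2)) :=
  (Submodule.span ℂ {v | ∃ r h ξ, v = π.tensorOrbit r h ξ}).topologicalClosure

/-- The vector `x ⊗ δ_r` is sent to `π(b) x ⊗ δ_{t r}`, which comes from the section supported at
`t` with value `b`. Reaching every basis vector `δ_r` is the reason for the parameter `r`. -/
theorem Rep.opTensor_mem_essentialSubspace {t : G} (b : B t)
    (v : HilbertTensor H (lp (fun _ : G => ℂ) 2)) :
    opTensor (π.toFun t b) (groupRegularRep t) v ∈ π.essentialSubspace := by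
  have hcl : IsClosed (π.essentialSubspace : Set (HilbertTensor H (lp (fun _ : G => ℂ) 2))) :=
    Submodule.isClosed_topologicalClosure _
  refine HilbertTensor.apply_mem_of_forall_tmulL_mem _ _ hcl (fun x y => ?_) v
  have h1 := ((hasSum_groupBasis y).mapL (HilbertTensor.tmulL x)).mapL
    (opTensor (π.toFun t b) (groupRegularRep t))
  refine hcl.mem_of_tendsto h1 (Filter.Eventually.of_forall fun s => Submodule.sum_mem _ fun r _ => ?_)
  rw [map_smul, map_smul, opTensor_tmulL, groupRegularRep_groupBasis, ← π.tensorOrbit_single]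
  exact Submodule.smul_mem _ _ (Submodule.le_topologicalClosure _
    (Submodule.subset_span ⟨_, _, _, rfl⟩))

end RepVectors
end FellBundle

/-! ### Comparison of the two norms on the algebra of pairs. -/

namespace FellBundle

variable {G : Type u} [Group G] {B : G → Type v}
  [∀ t, NormedAddCommGroup (B t)] [∀ t, NormedSpace ℂ (B t)] [∀ t, CompleteSpace (B t)]
  {𝓑 : FellBundle G B}

open scoped InnerProductSpace

variable {H : Type*} [NormedAddCommGroup H] [InnerProductSpace ℂ H] [CompleteSpace H]
  (π : 𝓑.Rep H)

/-- The pairs `(Λ(b), π(b) ⊗ λ_t)` for `b ∈ B t`. -/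
def Rep.regularPairs : Set (𝓑.Adjointable ×
    (HilbertTensor H (lp (fun _ : G => ℂ) 2) →L[ℂ] HilbertTensor H (lp (fun _ : G => ℂ) 2))) :=
  {p | ∃ (t : G) (b : B t), p = (𝓑.regularRep b, opTensor (π.toFun t b) (groupRegularRep t))}

theorem star_regularRep {t : G} (b : B t) :
    star (𝓑.regularRep b) = 𝓑.regularRep (𝓑.fstar rfl b) :=
  Adjointable.star_eq_of (𝓑.ip_leftMul b)

theorem Rep.star_mem_regularPairs {p} (hp : p ∈ π.regularPairs) : star p ∈ π.regularPairs := by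
  obtain ⟨t, b, rfl⟩ := hp
  refine ⟨t⁻¹, 𝓑.fstar rfl b, Prod.ext (star_regularRep b) ?_⟩
  rw [π.map_fstar, ← star_groupRegularRep]
  exact star_opTensor _ _

/-- The ⋆-algebra generated by the pairs `(Λ(b), π(b) ⊗ λ_t)`. -/
def Rep.pairAlgebra : NonUnitalStarSubalgebra ℂ (𝓑.Adjointable ×
    (HilbertTensor H (lp (fun _ : G => ℂ) 2) →L[ℂ] HilbertTensor H (lp (fun _ : G => ℂ) 2))) :=
  NonUnitalStarAlgebra.adjoin ℂ π.regularPairs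

variable {π}

/-- The generating set is ⋆-closed, so no ⋆-step is required of `P`; the properties proved with it
are not visibly stable under adjoints. -/
theorem Rep.induction_pairAlgebra {P : (𝓑.Adjointable ×
    (HilbertTensor H (lp (fun _ : G => ℂ) 2) →L[ℂ] HilbertTensor H (lp (fun _ : G => ℂ) 2))) → Prop}
    (mem : ∀ p ∈ π.regularPairs, P p) (zero : P 0) (add : ∀ p q, P p → P q → P (p + q))
    (smul : ∀ (z : ℂ) p, P p → P (z • p)) (mul : ∀ p q, P p → P q → P (p * q))
    {p} (hp : p ∈ π.pairAlgebra) : P p := by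
  have h : P p ∧ P (star p) := by
    refine NonUnitalStarAlgebra.adjoin_induction ℂ (p := fun p _ => P p ∧ P (star p))
      (fun p hp => ⟨mem p hp, mem _ (π.star_mem_regularPairs hp)⟩)
      (fun p q _ _ h h' => ⟨add _ _ h.1 h'.1, by rw [star_add]; exact add _ _ h.2 h'.2⟩)
      ⟨zero, by rw [star_zero]; exact zero⟩
      (fun p q _ _ h h' => ⟨mul _ _ h.1 h'.1, by rw [star_mul]; exact mul _ _ h'.2 h.2⟩)
      (fun z p _ h => ⟨smul _ _ h.1, by rw [star_smul]; exact smul _ _ h.2⟩)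
      (fun p _ h => ⟨h.2, by rw [star_star]; exact h.1⟩) hp
  exact h.1

theorem Rep.pairAlgebra_apply_tensorOrbit {p} (hp : p ∈ π.pairAlgebra) (r : G) (h : H)
    (ξ : 𝓑.L2) : p.2 (π.tensorOrbit r h ξ) = π.tensorOrbit r h (p.1.toCLM ξ) := by
  revert r h ξ
  refine Rep.induction_pairAlgebra (P := fun p => ∀ r h ξ,
    p.2 (π.tensorOrbit r h ξ) = π.tensorOrbit r h (p.1.toCLM ξ)) ?_ ?_ ?_ ?_ ?_ hp
  · rintro _ ⟨t, b, rfl⟩ r h ξ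
    exact π.opTensor_tensorOrbit r h b ξ
  · intro r h ξ
    exact (map_zero (π.tensorOrbit r h)).symm
  · intro p q hp hq r h ξ
    refine (congrArg₂ (· + ·) (hp r h ξ) (hq r h ξ)).trans ?_
    exact (map_add (π.tensorOrbit r h) _ _).symm
  · intro z p hp r h ξ
    refine (congrArg (z • ·) (hp r h ξ)).trans ?_
    exact (map_smul (π.tensorOrbit r h) _ _).symm
  · intro p q hp hq r h ξ
    refine (congrArg p.2 (hq r h ξ)).trans ?_
    exact hp r h _

theorem Rep.pairAlgebra_apply_mem {p} (hp : p ∈ π.pairAlgebra)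
    (v : HilbertTensor H (lp (fun _ : G => ℂ) 2)) : p.2 v ∈ π.essentialSubspace := by
  revert v
  refine Rep.induction_pairAlgebra (P := fun p => ∀ v, p.2 v ∈ π.essentialSubspace)
    ?_ ?_ ?_ ?_ ?_ hp
  · rintro _ ⟨t, b, rfl⟩ v
    exact π.opTensor_mem_essentialSubspace b v
  · exact fun v => zero_mem _
  · exact fun p q hp hq v => add_mem (hp v) (hq v)
  · exact fun z p hp v => Submodule.smul_mem _ z (hp v)
  · exact fun p q hp _ v => hp _

theorem Rep.norm_fst_le_norm_snd (hπ : ∀ a : B 1, ‖π.toFun 1 a‖ = ‖a‖) {p}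
    (hp : p ∈ π.pairAlgebra) : ‖p.1‖ ≤ ‖p.2‖ := by
  refine ContinuousLinearMap.opNorm_le_bound p.1.toCLM (norm_nonneg _) fun ξ => ?_
  -- Writing `⟨T ξ, T ξ⟩ = c⋆ c` turns `‖T ξ‖` into the operator norm of `π(c)`, which can be tested
  -- on vectors `h`; then `‖π(c) h‖` is the norm of an orbit vector with `r = 1`.
  obtain ⟨c, hc⟩ := CStarAlgebra.nonneg_iff_eq_star_mul_self.1
    (L2.ip_self_nonneg (p.1.toCLM ξ))
  have h1 : ‖p.1.toCLM ξ‖ = ‖π.unitHom c‖ := by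
    rw [← sq_eq_sq₀ (norm_nonneg _) (norm_nonneg _), L2.norm_sq, hc,
      CStarRing.norm_star_mul_self, ← sq]
    exact congrArg (· ^ 2) (hπ c).symm
  rw [h1]
  refine ContinuousLinearMap.opNorm_le_bound _ (by positivity) fun h => ?_
  have h2 : ‖π.unitHom c h‖ = ‖π.tensorOrbit 1 h (p.1.toCLM ξ)‖ := by
    rw [← sq_eq_sq₀ (norm_nonneg _) (norm_nonneg _), π.norm_tensorOrbit_sq, hc, map_mul, map_star,
      ← inner_self_eq_norm_sq (𝕜 := ℂ), ContinuousLinearMap.star_eq_adjoint]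
    exact congrArg RCLike.re (ContinuousLinearMap.adjoint_inner_right _ _ _).symm
  rw [h2, ← Rep.pairAlgebra_apply_tensorOrbit hp, mul_assoc]
  exact (p.2.le_opNorm _).trans
    (mul_le_mul_of_nonneg_left (π.norm_tensorOrbit_le _ _ _) (norm_nonneg _))

/-- Orbit vectors for different `r` and `h` need not be orthogonal, so bounds for the individual
terms do not add up to the right bound for a sum. A growth bound on powers with a constant depending
on the vector does pass to sums, and it suffices. -/
theorem Rep.norm_apply_le_of_mem_essentialSubspace {p} (hp : p ∈ π.pairAlgebra)
    {v : HilbertTensor H (lp (fun _ : G => ℂ) 2)} (hv : v ∈ π.essentialSubspace) :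
    ‖p.2 v‖ ≤ ‖p.1‖ * ‖v‖ := by
  refine closure_minimal (t := {v | ‖p.2 v‖ ≤ ‖p.1‖ * ‖v‖}) (fun v hv => ?_)
    (isClosed_le (by fun_prop) (by fun_prop)) hv
  have hq : star p * p ∈ π.pairAlgebra := mul_mem (star_mem hp) hp
  have hpow (n : ℕ) (r : G) (h : H) (ξ : 𝓑.L2) : ((star p.2 * p.2) ^ n) (π.tensorOrbit r h ξ) =
      π.tensorOrbit r h (((star p.1 * p.1) ^ n).toCLM ξ) := by
    induction n generalizing ξ with
    | zero => rw [pow_zero, pow_zero]; rfl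
    | succ n ih =>
      rw [pow_succ, pow_succ]
      refine (congrArg ((star p.2 * p.2) ^ n)
        (Rep.pairAlgebra_apply_tensorOrbit hq r h ξ)).trans ?_
      exact ih _
  have hbound : ∃ C : ℝ, ∀ n : ℕ, ‖((star p.2 * p.2) ^ n) v‖ ≤ C * (‖p.1‖ ^ 2) ^ n := by
    have hnorm (n : ℕ) (ξ : 𝓑.L2) :
        ‖((star p.1 * p.1) ^ n).toCLM ξ‖ ≤ (‖p.1‖ ^ 2) ^ n * ‖ξ‖ := by
      induction n generalizing ξ with
      | zero => rw [pow_zero, pow_zero, one_mul]; exact le_rfl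
      | succ n ih =>
        rw [pow_succ, pow_succ, mul_assoc]
        refine (ih ((star p.1 * p.1).toCLM ξ)).trans ?_
        gcongr
        refine ContinuousLinearMap.le_of_opNorm_le _ ?_ ξ
        exact (CStarRing.norm_star_mul_self (x := p.1)).le.trans (sq _).ge
    induction hv using Submodule.span_induction with
    | mem v hv =>
      obtain ⟨r, h, ξ, rfl⟩ := hv
      refine ⟨‖ξ‖ * ‖h‖, fun n => ?_⟩
      rw [hpow]
      refine (π.norm_tensorOrbit_le _ _ _).trans ?_
      calc _ ≤ ((‖p.1‖ ^ 2) ^ n * ‖ξ‖) * ‖h‖ := by gcongr; exact hnorm n ξ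
        _ = _ := by ring
    | zero => exact ⟨0, fun n => by rw [map_zero, norm_zero, zero_mul]⟩
    | add v w _ _ hv hw =>
      obtain ⟨C, hC⟩ := hv
      obtain ⟨D, hD⟩ := hw
      refine ⟨C + D, fun n => ?_⟩
      rw [map_add, add_mul]
      exact (norm_add_le _ _).trans (add_le_add (hC n) (hD n))
    | smul z v _ hv =>
      obtain ⟨C, hC⟩ := hv
      refine ⟨‖z‖ * C, fun n => ?_⟩
      rw [map_smul, norm_smul, mul_assoc]
      exact mul_le_mul_of_nonneg_left (hC n) (norm_nonneg z)
  obtain ⟨C, hC⟩ := hbound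
  have h1 := p.2.norm_apply_sq_le_of_norm_pow_apply_le v (by positivity) hC
  rw [← mul_pow] at h1
  exact (sq_le_sq₀ (norm_nonneg _) (by positivity)).1 h1

/-- The previous bound holds on a subspace that may be proper, but the range of `star p.2` lies
there. This bounds `‖p.2 * star p.2‖ = ‖p.2‖²` by `‖p.1‖ * ‖p.2‖`. -/
theorem Rep.norm_snd_le_norm_fst {p} (hp : p ∈ π.pairAlgebra) : ‖p.2‖ ≤ ‖p.1‖ := by
  have h1 : ‖p.2 * star p.2‖ ≤ ‖p.1‖ * ‖p.2‖ := by
    refine ContinuousLinearMap.opNorm_le_bound _ (by positivity) fun v => ?_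
    refine (Rep.norm_apply_le_of_mem_essentialSubspace hp
      (Rep.pairAlgebra_apply_mem (star_mem hp) v)).trans ?_
    rw [mul_assoc]
    refine mul_le_mul_of_nonneg_left ?_ (norm_nonneg _)
    have h2 := (star p.2).le_opNorm v
    rwa [norm_star] at h2
  rw [CStarRing.norm_self_mul_star] at h1
  rcases (norm_nonneg p.2).eq_or_lt with h0 | h0
  · rw [← h0]; exact norm_nonneg _
  · exact le_of_mul_le_mul_right h1 h0

end FellBundle

end

/-! ### The embedding of the reduced algebra. -/

theorem corollary3p5 {G : Type u} [Group G] {B : G → Type v}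
    [∀ t, NormedAddCommGroup (B t)] [∀ t, NormedSpace ℂ (B t)] [∀ t, CompleteSpace (B t)]
    (𝓑 : FellBundle G B) :
    ∃ Φ : 𝓑.reducedAlgebra →⋆ₙₐ[ℂ] minTensor 𝓑.fullAlgebra (reducedGroupAlgebra G),
      Function.Injective Φ ∧
        ∀ (t : G) (b : B t),
          Φ (𝓑.toReduced b) = minTensor.tmul (𝓑.toFull b) (groupUnitary t) := by
  -- `Ψ` takes values in all bounded operators; the inclusions `hle` and `hle'` only match its
  -- domain and range with the two algebras of the statement.
  obtain ⟨Ψ, hnorm, hmem, hΨ⟩ := exists_starHom_of_norm_eq 𝓑.univRep.regularPairs fun p hp =>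
    le_antisymm (FellBundle.Rep.norm_fst_le_norm_snd FellBundle.norm_univRep_one hp)
      (FellBundle.Rep.norm_snd_le_norm_fst hp)
  have hle : 𝓑.reducedAlgebra ≤ (NonUnitalStarAlgebra.adjoin ℂ
      (Prod.fst '' 𝓑.univRep.regularPairs)).topologicalClosure :=
    NonUnitalStarSubalgebra.topologicalClosure_mono (NonUnitalStarAlgebra.adjoin_mono (by
      rintro _ ⟨t, b, rfl⟩
      exact ⟨_, ⟨t, b, rfl⟩, rfl⟩))
  have hle' : (NonUnitalStarAlgebra.adjoin ℂ
      (Prod.snd '' 𝓑.univRep.regularPairs)).topologicalClosure ≤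
      minTensor 𝓑.fullAlgebra (reducedGroupAlgebra G) :=
    NonUnitalStarSubalgebra.topologicalClosure_mono (NonUnitalStarAlgebra.adjoin_mono (by
      rintro _ ⟨_, ⟨t, b, rfl⟩, rfl⟩
      exact ⟨_, (𝓑.toFull b).2, _, (groupUnitary t).2, rfl⟩))
  refine ⟨(NonUnitalStarAlgHom.codRestrict Ψ _ fun x => hle' (hmem x)).comp
    (NonUnitalStarSubalgebra.inclusion hle), fun x y hxy => ?_, fun t b => Subtype.ext ?_⟩
  · have h1 : Ψ (NonUnitalStarSubalgebra.inclusion hle x) =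
        Ψ (NonUnitalStarSubalgebra.inclusion hle y) := congrArg Subtype.val hxy
    have h2 := hnorm (NonUnitalStarSubalgebra.inclusion hle x -
      NonUnitalStarSubalgebra.inclusion hle y)
    rw [map_sub, h1, sub_self, norm_zero] at h2
    exact NonUnitalStarSubalgebra.inclusion_injective hle
      (sub_eq_zero.1 (norm_eq_zero.1 h2.symm))
  · exact hΨ _ ⟨t, b, rfl⟩ (hle (𝓑.toReduced b).2)
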